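/- **Setting.** Let $\tau$ be a finite vocabulary of operation symbols, all of positive arity, listed in a fixed order, let $\mathbf A$ be a finite (nonempty) $\tau$-algebra with universe $A$, and let $R\subseteq A^n$. The relation $R$ is *qf-definable* in $\mathbf A$ if $R=\{\bar a\in A^n:\mathbf A\models\varphi(\bar a)\}$ for some quantifier-free $\tau$-formula $\varphi(x_0,\dots,x_{n-1})$. For $\bar a,\bar b\in A^k$ write $\bar a\approx\bar b$ if for all terms $t,s$ in $x_0,\dots,x_{k-1}$ we have $t^{\mathbf A}(\bar a)=s^{\mathbf A}(\bar a)\iff t^{\mathbf A}(\bar b)=s^{\mathbf A}(\bar b)$. A *subisomorphism* of $\mathbf A$ is an injective map $\gamma:D\to A$, where $D\subseteq A$ is nonempty and closed under the operations, that preserves the graphs of the operations. For a set $S$ let $S^{(k)}$ be the set of $k$-tuples over $S$ without repeated entries. Let $\lfloor\bar a\rfloor$ be $\bar a$ with every entry equal to a prior entry deleted; for $\bar a\in R$ let $\lfloor R_{\bar a}\rfloor=\{\lfloor \bar b\rfloor:\bar b\in R,\ \forall i,j\ (b_i=b_j\Leftrightarrow a_i=a_j)\}$. Let $R_1,\dots,R_l$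 be the distinct relations among these, $\mathrm{spec}(R)=\{|\lfloor\bar a\rfloor|:\bar a\in R\}$, and $\mathrm{relType}(\bar a)=(R_1(\bar a),\dots,R_l(\bar a))$. Write $\Sigma(S)=\bigcup_{k\in\mathrm{spec}(R)}S^{(k)}$. **Subroutine $\mathtt{IsoType}(\bar a)$**, $\bar a=(a_0,\dots,a_{m-1})$. Start with the list $V=[a_0,\dots,a_{m-1}]$, the partition $P$ of $\{0,\dots,m-1\}$ with $i,j$ in the same block iff $a_i=a_j$, the increasing list $H$ of the least elements of the blocks, and $N=H$. While $N\neq[\,]$: let $H_{old}=H$; for each arity $r$ occurring in $\tau$ in increasing order, for each $f\in\tau$ of arity $r$ in the order of $\tau$, and for each $\bar l\in H_{old}^r$ having an entry in $N$, in lexicographic order, append $v=f^{\mathbf A}(V[l_0],\dots,V[l_{r-1}])$ to $V$, with index $i$ say; if $v=V[j]$ for some $j\in H$, add $i$ to the block of $j$ in $P$; otherwise add the block $\{i\}$ to $P$ and append $i$ to $H$. Then let $N$ be the list of the elements of $H$ not in $H_{old}$. Return $P$ and $U=[V[j]:j\in H]$. **Merging Algorithm.** For each $k\in\mathrm{spec}(R)$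 keep a set $\mathtt{orbits}_k$ of annotated blocks (*orbits*) $(B,RT,T,U)$, $B\subseteq A^{(k)}$, initially $\{(\{\bar a\},\mathrm{relType}(\bar a),\text{unknown},\text{unknown}):\bar a\in A^{(k)}\}$. Keep a stack of triples $(S,L,G)$ ($S\subseteq A$, $L$ a list of tuples, $G$ a set of tuples), initially the single entry $(A,L_0,\emptyset)$, where $L_0$ lists $\Sigma(A)$. While the stack is nonempty, with top $(S,L,G)$: if $L$ is empty, delete the top. Otherwise remove the first element $\bar a$ of $L$. If the orbit of $\bar a$ has a known $T$, do nothing more with $\bar a$. Otherwise compute $(P,U)=\mathtt{IsoType}(\bar a)$. * If $|U|=|S|$: if the orbit of some element of $G$ is $(B',RT',T',U')$ with $T'=P$, call $\mathtt{merge}(\gamma)$, where $\gamma:U[i]\mapsto U'[i]$, and return $\mathrm{False}$ if the call fails; if there is no such orbit, tag the orbit of $\bar a$ with $(P,U)$ (that is, set its last two components to $P$ and $U$) and add $\bar a$ to $G$. * If $|U|\ne|S|$: if some $(B',RT',T',U')\in\mathtt{orbits}_{|\bar a|}$ has $T'=P$, call $\mathtt{merge}(\gamma)$ for $\gamma:U[i]\mapsto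 U'[i]$ and return $\mathrm{False}$ if the call fails; if there is no such orbit, tag the orbit of $\bar a$ with $(P,U)$ and push $(U,L',\{\bar a\})$, where $L'$ lists $\Sigma(U)$. (If $L$ is now empty, the new top entry may or may not be deleted again at once; the result below holds in either case.) When the stack is empty, return $\mathrm{True}$. The procedure $\mathtt{merge}(\gamma)$ runs through the tuples $\bar c\in\Sigma(\mathrm{dom}\,\gamma)$; whenever $\bar c$ and $\gamma(\bar c)$ lie in different orbits, it fails if these have different relTypes $RT$, and otherwise replaces both orbits by one whose block is the union of their blocks, with the same $RT$, and with the $T,U$ of the orbit of $\bar c$ if that one is tagged and those of the orbit of $\gamma(\bar c)$ otherwise. **Proposition (soundness and completeness of the Merging Algorithm).** Whatever orders are chosen for the lists $L_0$, $L'$ and for the loop in $\mathtt{merge}$, and whichever orbit $(B',RT',T',U')$ with the required property is taken, on input $\mathbf A$, $R$: 1. the algorithm terminates (every execution is finite and ends by returning a truth value; in particular all calls of $\mathtt{IsoType}$ terminate); 2. it returns $\mathrm{True}$ if and only if $R$ is qf-definable in $\mathbf A$; 3. when it returns $\mathrm{True}$, for each $k\in\mathrm{spec}(R)$ the blocks of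 the orbits in $\mathtt{orbits}_k$ are exactly the $\approx$-classes of $A^{(k)}$; 4. every map $\gamma$ for which $\mathtt{merge}(\gamma)$ is called is a subisomorphism of $\mathbf A$. -/

import Mathlib

namespace QFMerging

open FirstOrder

section Semantics

variable {L : Language} {A : Type*} [L.Structure A]

/-- `R ⊆ Aⁿ` is the extension of a quantifier-free formula in the variables `x₀, …, xₙ₋₁`. -/
def QfDefinable (L : Language) {A : Type*} [L.Structure A] {n : ℕ} (R : Set (Fin n → A)) : Prop :=
  ∃ φ : L.Formula (Fin n), Language.BoundedFormula.IsQF φ ∧ R = {a | φ.Realize a}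

/-- Isomorphic tuples, `a ≈ b`: the same identities between terms hold at `a` and at `b`. -/
def TupleIso (L : Language) {A : Type*} [L.Structure A] {k : ℕ} (a b : Fin k → A) : Prop :=
  ∀ t s : L.Term (Fin k), t.realize a = s.realize a ↔ t.realize b = s.realize b

/-- A partial map `dom → A`, `dom ⊆ A`; the values of `toFun` outside `dom` are irrelevant. -/
structure PartialMap (A : Type*) where
  dom : Set A
  toFun : A → A

/-- A subisomorphism: an injective partial map whose domain is a subuniverse (nonempty and closed
under the operations) and which preserves the graphs of the operations. -/
def IsSubisomorphism (L : Language) {A : Type*} [L.Structure A] (γ : PartialMap A) : Prop :=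
  Set.InjOn γ.toFun γ.dom ∧
  γ.dom.Nonempty ∧
  (∀ (r : ℕ) (f : L.Functions r), Language.ClosedUnder f γ.dom) ∧
  ∀ (r : ℕ) (f : L.Functions r) (x : Fin r → A) (y : A), (∀ i, x i ∈ γ.dom) → y ∈ γ.dom →
    Language.Structure.funMap f x = y →
      Language.Structure.funMap f (fun i => γ.toFun (x i)) = γ.toFun y

end Semantics

/-- An ordered presentation of a finite algebraic vocabulary: the increasing list of the arities
that occur, and for each arity `r` the list of the operation symbols of arity `r`. -/
structure Vocabulary (L : Language) where
  arities : List ℕ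
  arities_sorted : arities.Pairwise (· < ·)
  mem_arities : ∀ r, r ∈ arities ↔ Nonempty (L.Functions r)
  op : (r : ℕ) → List (L.Functions r)
  nodup_op : ∀ r, (op r).Nodup
  mem_op : ∀ r (f : L.Functions r), f ∈ op r

/-! ### The subroutine `IsoType`

A tuple of unspecified length is a list. Partitions of sets of indices are finite sets of blocks. -/

section IsoType

variable {L : Language} {A : Type*} [L.Structure A] [Nonempty A] [DecidableEq A]

/-- The variables of a run of `IsoType`. -/
structure IsoState (A : Type*) where
  V : List A
  P : Finset (Finset ℕ)
  H : List ℕ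
  N : List ℕ

/-- `V[i]`. (All indices used by the algorithm are within range.) -/
noncomputable def IsoState.val (s : IsoState A) (i : ℕ) : A :=
  s.V.getD i (Classical.arbitrary A)

/-- The partition of `{0, …, n-1}` in which `i, j` are in the same block iff `aᵢ = aⱼ`. -/
def indexPartition (a : List A) : Finset (Finset ℕ) :=
  (Finset.range a.length).image
    (fun i => (Finset.range a.length).filter (fun j => a[j]? = a[i]?))

/-- The increasing list of the least elements of the blocks of `indexPartition a`. -/
def firstIndices (a : List A) : List ℕ :=
  (List.range a.length).filter
    (fun i => decide (∀ B ∈ indexPartition a, i ∈ B → ∀ j ∈ B, i ≤ j))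

def isoInit (a : List A) : IsoState A where
  V := a
  P := indexPartition a
  H := firstIndices a
  N := firstIndices a

/-- All `r`-tuples with entries in a list; lexicographically ordered if the list is increasing. -/
def tuplesOver (H : List ℕ) : (r : ℕ) → List (Fin r → ℕ)
  | 0 => [Fin.elim0]
  | r + 1 => H.flatMap (fun x => (tuplesOver H r).map (fun l => Fin.cons x l))

/-- The list `T`: the tuples over `H_old` having at least one entry in `N`. -/
def newTuples (H_old N : List ℕ) (r : ℕ) : List (Fin r → ℕ) :=
  (tuplesOver H_old r).filter (fun l => decide (∃ j, l j ∈ N))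

/-- The innermost loop body: evaluate `f` at the entries of `V` with indices `l`, append the value
to `V`, and update `P` and `H`. -/
noncomputable def isoBody {r : ℕ} (f : L.Functions r) (s : IsoState A) (l : Fin r → ℕ) :
    IsoState A :=
  let value : A := Language.Structure.funMap f (fun i => s.val (l i))
  let m : ℕ := s.V.length
  match s.H.find? (fun j => decide (s.val j = value)) with
  | some j =>
      { V := s.V ++ [value]
        P := s.P.image (fun B => if j ∈ B then insert m B else B)
        H := s.H
        N := s.N }
  | none =>
      { V := s.V ++ [value]
        P := insert {m} s.P
        H := s.H ++ [m]
        N := s.N }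

/-- One pass through the while loop of `IsoType`. -/
noncomputable def isoPass (τ : Vocabulary L) (s : IsoState A) : IsoState A :=
  let s' : IsoState A :=
    τ.arities.foldl (fun s₁ r =>
      (τ.op r).foldl (fun s₂ f =>
        (newTuples s.H s.N r).foldl (isoBody f) s₂) s₁) s
  { V := s'.V
    P := s'.P
    H := s'.H
    N := s'.H.filter (fun l => decide (l ∉ s.H)) }

/-- The call `IsoType(A, a)` halts and returns the partition `P` and the list `U`. -/
def IsoTypeReturns (τ : Vocabulary L) (a : List A) (P : Finset (Finset ℕ)) (U : List A) : Prop :=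
  ∃ m : ℕ, (∀ j < m, ((isoPass τ)^[j] (isoInit a)).N ≠ []) ∧
    ((isoPass τ)^[m] (isoInit a)).N = [] ∧
    P = ((isoPass τ)^[m] (isoInit a)).P ∧
    U = ((isoPass τ)^[m] (isoInit a)).H.map ((isoPass τ)^[m] (isoInit a)).val

end IsoType

/-! ### Preprocessing of the input relation -/

section Preprocessing

variable {A : Type*} [DecidableEq A]

/-- `⌊a⌋`: delete every entry equal to a prior entry. -/
def floorTuple : List A → List A
  | [] => []
  | x :: l => x :: (floorTuple l).filter (fun y => decide (y ≠ x))

/-- `⌊R⌋`. -/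
def floorRel {n : ℕ} (R : Set (Fin n → A)) : Set (List A) :=
  {t | ∃ a ∈ R, t = floorTuple (List.ofFn a)}

/-- The pattern of `a`, a partition of the index set given as an equivalence relation:
`i, j` are related iff `aᵢ = aⱼ`. -/
def pattern {n : ℕ} (a : Fin n → A) : Setoid (Fin n) := Setoid.ker a

/-- The set of all relations `⌊R_θ⌋`, where `θ` is the pattern of some `a ∈ R`. -/
def targets {n : ℕ} (R : Set (Fin n → A)) : Set (Set (List A)) :=
  {T | ∃ a ∈ R, T = floorRel {b | b ∈ R ∧ pattern b = pattern a}}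

def spec {n : ℕ} (R : Set (Fin n → A)) : Set ℕ :=
  {k | ∃ a ∈ R, k = (floorTuple (List.ofFn a)).length}

/-- The tuple of truth values, indexed by the target relations, telling which of them hold at
`a`. -/
def relType {n : ℕ} (R : Set (Fin n → A)) (a : List A) : targets R → Prop :=
  fun T => a ∈ T.1

end Preprocessing

/-! ### The Merging Algorithm -/

section Merging

variable {L : Language} {A : Type*} [L.Structure A] [Nonempty A] [DecidableEq A]
variable {n : ℕ} {R : Set (Fin n → A)}

/-- An annotated block `(B, RT, T, U)`; `none` is the value "unknown". -/
@[ext] structure Orbit (R : Set (Fin n → A)) where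
  B : Set (List A)
  RT : targets R → Prop
  T : Option (Finset (Finset ℕ))
  U : Option (List A)

/-- The data `orbits_k`, for every `k` (it is empty if `k` is not in the spectrum). -/
abbrev Orbits (R : Set (Fin n → A)) := ℕ → Set (Orbit R)

/-- `O` is the orbit containing the tuple `a`. -/
def Orbits.IsOrbitOf (o : Orbits R) (a : List A) (O : Orbit R) : Prop :=
  O ∈ o a.length ∧ a ∈ O.B

/-- Delete the orbits in `old` from `orbits_k`, and then add the orbit `new` to it. -/
def Orbits.replace (o : Orbits R) (k : ℕ) (old : Set (Orbit R)) (new : Orbit R) : Orbits R :=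
  Function.update o k (insert new (o k \ old))

/-- The orbits at the start: singletons annotated with their relType. -/
def initOrbits (R : Set (Fin n → A)) : Orbits R := fun k =>
  {O | k ∈ spec R ∧ ∃ a : List A, a.length = k ∧ a.Nodup ∧ O = ⟨{a}, relType R a, none, none⟩}

/-- The orbit `O` tagged with an isomorphism type and a universe. -/
def Orbit.tag (O : Orbit R) (T : Finset (Finset ℕ)) (U : List A) : Orbit R :=
  ⟨O.B, O.RT, some T, some U⟩

/-- The merge of two orbits. The tags of the first are kept if it is tagged, otherwise those of the
second. -/
def Orbit.merge (O O' : Orbit R) : Orbit R where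
  B := O.B ∪ O'.B
  RT := O.RT
  T := if O.T.isSome then O.T else if O'.T.isSome then O'.T else none
  U := if O.T.isSome then O.U else if O'.T.isSome then O'.U else none

/-- `l` lists, without repetitions and in some order, the tuples without repeated entries whose
entries are in `S` and whose length is in the spectrum, i.e. the set `⋃_{k ∈ spec R} S⁽ᵏ⁾`. -/
def IsTupleList (R : Set (Fin n → A)) (S : Set A) (l : List (List A)) : Prop :=
  l.Nodup ∧ ∀ a : List A, a ∈ l ↔ a.length ∈ spec R ∧ a.Nodup ∧ ∀ x ∈ a, x ∈ S

/-- The map with `U[i] ↦ U'[i]` for all `i`. -/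
def mapOfLists (U U' : List A) : PartialMap A where
  dom := {x | x ∈ U}
  toFun x := U'.getD (U.idxOf x) x

/-- The loop of `try_merge_orbits(γ, orbits)` over a list of tuples.
`TryMerge γ l o b o'`: started with the orbits `o`, it can return the truth value `b` and leave the
orbits `o'`. -/
inductive TryMerge (γ : PartialMap A) : List (List A) → Orbits R → Bool → Orbits R → Prop
  | done (o : Orbits R) : TryMerge γ [] o true o
  | same {a l o b o'} (O : Orbit R) :
      o.IsOrbitOf a O → o.IsOrbitOf (a.map γ.toFun) O →
      TryMerge γ l o b o' → TryMerge γ (a :: l) o b o'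
  | differ {a l o} (O O' : Orbit R) :
      o.IsOrbitOf a O → o.IsOrbitOf (a.map γ.toFun) O' → O ≠ O' → O.RT ≠ O'.RT →
      TryMerge γ (a :: l) o false o
  | merge {a l o b o'} (O O' : Orbit R) :
      o.IsOrbitOf a O → o.IsOrbitOf (a.map γ.toFun) O' → O ≠ O' → O.RT = O'.RT →
      TryMerge γ l (o.replace a.length {O, O'} (O.merge O')) b o' →
      TryMerge γ (a :: l) o b o'

/-- A stack entry `(S, L, G)`: a subuniverse, the tuples still to be processed, and generators. -/
structure Frame (A : Type*) where
  S : Finset A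
  L : List (List A)
  G : Set (List A)

/-- The states of the Merging Algorithm: at the head of the loops, about to call
`try_merge_orbits(γ, orbits)`, or halted with a returned truth value. -/
inductive State (R : Set (Fin n → A)) where
  | loop (o : Orbits R) (stack : List (Frame A))
  | merging (γ : PartialMap A) (o : Orbits R) (stack : List (Frame A))
  | halt (b : Bool) (o : Orbits R)

/-- The result of appending a new node to the stack and leaving the inner loop is either the
stack with the new node on top or, if the list of the former top is exhausted, the stack with its
top deleted again: the test `tuples_to_process = []` made at that point refers to the top entry or
to the entry that was processed, and both readings are admitted. -/
inductive PushResult (new : Frame A) : Frame A → List (Frame A) → List (Frame A) → Prop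
  | push (old rest) : PushResult new old rest (new :: old :: rest)
  | drop (S G rest) : PushResult new ⟨S, [], G⟩ rest (⟨S, [], G⟩ :: rest)

/-- The steps of the Merging Algorithm. Every choice that it leaves open (the order in which the
tuples of a list are processed, which orbit with a given property is taken) may be made
arbitrarily. -/
inductive Step (τ : Vocabulary L) : State R → State R → Prop
  /-- The stack is empty: return `True`. -/
  | finish (o) : Step τ (.loop o []) (.halt true o)
  /-- The top of the stack has no more tuples to process: delete it. -/
  | pop (o S G st) : Step τ (.loop o (⟨S, [], G⟩ :: st)) (.loop o st)
  /-- The type of `a` is known. -/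
  | known {o S a l G st} (O : Orbit R) :
      o.IsOrbitOf a O → O.T ≠ none →
      Step τ (.loop o (⟨S, a :: l, G⟩ :: st)) (.loop o (⟨S, l, G⟩ :: st))
  /-- `Sg(a)` is not smaller than `S`, and the orbit `O'` of some generator has the type of `a`. -/
  | sameFound {o S a l G st P U U'} (O : Orbit R) (g : List A) (O' : Orbit R) :
      o.IsOrbitOf a O → O.T = none → IsoTypeReturns τ a P U →
      U.length = S.card →
      g ∈ G → o.IsOrbitOf g O' → O'.T = some P → O'.U = some U' →
      Step τ (.loop o (⟨S, a :: l, G⟩ :: st))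
        (.merging (mapOfLists U U') o (⟨S, l, G⟩ :: st))
  /-- `Sg(a)` is not smaller than `S`, and no orbit of a generator has the type of `a`. -/
  | sameNew {o S a l G st P U} (O : Orbit R) :
      o.IsOrbitOf a O → O.T = none → IsoTypeReturns τ a P U →
      U.length = S.card →
      (∀ g ∈ G, ∀ O' : Orbit R, o.IsOrbitOf g O' → O'.T ≠ some P) →
      Step τ (.loop o (⟨S, a :: l, G⟩ :: st))
        (.loop (o.replace a.length {O} (O.tag P U)) (⟨S, l, insert a G⟩ :: st))
  /-- `Sg(a)` is smaller than `S`, and some orbit `O'` has the type of `a`. -/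
  | smallerFound {o S a l G st P U U'} (O O' : Orbit R) :
      o.IsOrbitOf a O → O.T = none → IsoTypeReturns τ a P U →
      U.length ≠ S.card →
      O' ∈ o a.length → O'.T = some P → O'.U = some U' →
      Step τ (.loop o (⟨S, a :: l, G⟩ :: st))
        (.merging (mapOfLists U U') o (⟨S, l, G⟩ :: st))
  /-- `Sg(a)` is smaller than `S`, and no orbit has the type of `a`: push a new node. -/
  | smallerNew {o S a l G st P U l' st'} (O : Orbit R) :
      o.IsOrbitOf a O → O.T = none → IsoTypeReturns τ a P U →
      U.length ≠ S.card →
      (∀ O' ∈ o a.length, O'.T ≠ some P) →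
      IsTupleList R {x | x ∈ U} l' →
      PushResult ⟨U.toFinset, l', {a}⟩ ⟨S, l, G⟩ st st' →
      Step τ (.loop o (⟨S, a :: l, G⟩ :: st))
        (.loop (o.replace a.length {O} (O.tag P U)) st')
  /-- A call of `try_merge_orbits` returns `True`. -/
  | mergeTrue {γ o o' st l} :
      IsTupleList R γ.dom l → TryMerge γ l o true o' →
      Step τ (.merging γ o st) (.loop o' st)
  /-- A call of `try_merge_orbits` returns `False`: return `False`. -/
  | mergeFalse {γ o o' st l} :
      IsTupleList R γ.dom l → TryMerge γ l o false o' →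
      Step τ (.merging γ o st) (.halt false o')

/-- `s` is a state in which the algorithm may be after initialization on input `A, R`. -/
def IsInitial [Fintype A] (R : Set (Fin n → A)) (s : State R) : Prop :=
  ∃ l, IsTupleList R Set.univ l ∧ s = .loop (initOrbits R) [⟨Finset.univ, l, ∅⟩]

/-- `s` occurs in some execution on input `A, R`. -/
def Reachable [Fintype A] (τ : Vocabulary L) (R : Set (Fin n → A)) (s : State R) : Prop :=
  ∃ s₀, IsInitial R s₀ ∧ Relation.ReflTransGen (Step τ) s₀ s

end Merging

end QFMerging

/-!
**Isomorphism of tuples.** Two tuples satisfy the same identities between terms if and only if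
some partial isomorphism, i.e. an injective map that is defined on a subuniverse and commutes with
the operations, takes the one to the other (`tupleIso_iff_isomorphic`). Over a finite algebra a
relation is quantifier-free definable if and only if it is closed under isomorphism of tuples, which
amounts to relType being constant on the isomorphism classes of tuples without repeated entries
(`qfDefinable_iff_relType`).

**`IsoType`.** Throughout a run, `P` and `H` are determined by the list `V`, and the evaluations
performed in a pass are determined by the values of `H` and `N`. So the runs on two tuples are
synchronous as long as the lists `V` have the same kernel. In a halted run, each operation has been
evaluated exactly once at each tuple of indices from `H`; hence the final partition determines the
length of the input, and two inputs for which the same partition is returned have synchronous runs.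
Matching the values of these runs is a partial isomorphism
(`IsoTypeReturns.isPartialIso_mapOfLists`). Conversely, partial isomorphisms carry runs to runs
(`IsoTypeReturns.map`).

**The Merging Algorithm.** Orbits are merged only along partial isomorphisms, so isomorphic tuples
are the only ones that share an orbit. This gives soundness: a failing merge exhibits isomorphic
tuples of different relTypes. Completeness means that, when the stack is empty, isomorphic tuples
share an orbit. All tuples are tagged by then, so it suffices that there never are two tagged orbits
in one isomorphism class. Two further invariants are needed for this.

* If `c` and `d` share an orbit, then some partial isomorphism `δ` takes `c` to `d`, and `e` and
  `δ e` share an orbit for all tuples `e` over its domain (`Orbits.Liftable`). The reason is that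
  each merge treats all tuples over the domain of the map.
* The orbit of a tagged tuple `c` contains a generator of some stack entry, or else all tuples
  over the subuniverse generated by `c` are tagged (`Cover`).

Suppose that `a` generates the subuniverse `S` of the top entry, and that `b` is a tagged tuple
isomorphic to the untagged `a`. In the first case of `Cover`, the orbit of `b` contains a generator
of an entry, which is the top one as the sizes of the subuniverses on the stack are different; so
the type of `a` is found. In the second case, if the top entry is the whole algebra, then so is the
subuniverse generated by `b`, and `a` is tagged. Otherwise the copy of a generator `g` of the top
entry in the subuniverse generated by `b` is tagged, hence shares its orbit with `g`; lifting gives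
that `a` and `b` share an orbit. Either way `a` is tagged, a contradiction
(`not_isomorphic_of_generators`).

**Termination.** The number of untagged tuples never increases, it decreases when an entry is
pushed, and every other step reduces the work left on the stack (`Step.weight_lt`).
-/

namespace QFMerging

open FirstOrder

/-! ### The kernel of a list of values -/

section Kernel

variable {A : Type*}

/-- Two lists of the same length with equal entries at the same pairs of positions. -/
def SameKer (V W : List A) : Prop :=
  V.length = W.length ∧ ∀ i j : ℕ, V[i]? = V[j]? ↔ W[i]? = W[j]?

theorem SameKer.of_prefix {V W V' W' : List A} (h : SameKer V' W') (hV : V <+: V')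
    (hW : W <+: W') (hlen : V.length = W.length) : SameKer V W := by
  obtain ⟨X, rfl⟩ := hV
  obtain ⟨Y, rfl⟩ := hW
  refine ⟨hlen, fun i j => ?_⟩
  by_cases hi : i < V.length <;> by_cases hj : j < V.length
  · have := h.2 i j
    rwa [List.getElem?_append_left hi, List.getElem?_append_left hj,
      List.getElem?_append_left (hlen ▸ hi), List.getElem?_append_left (hlen ▸ hj)] at this
  · simp [hi, hj, hlen ▸ hi, show W.length ≤ j by omega]
  · simp [hi, hj, hlen ▸ hj, show W.length ≤ i by omega]
  · simp [show W.length ≤ j by omega, show V.length ≤ j by omega,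
      show W.length ≤ i by omega, show V.length ≤ i by omega]

theorem sameKer_map {V : List A} {g : A → A} {D : Set A} (hg : Set.InjOn g D)
    (hV : ∀ x ∈ V, x ∈ D) : SameKer V (V.map g) := by
  refine ⟨by simp, fun i j => ?_⟩
  simp only [List.getElem?_map]
  constructor
  · intro h; rw [h]
  · intro h
    by_cases hi : i < V.length <;> by_cases hj : j < V.length
    · simp only [hi, hj, List.getElem?_eq_getElem, Option.map_some, Option.some.injEq] at h ⊢
      exact hg (hV _ (List.getElem_mem hi)) (hV _ (List.getElem_mem hj)) h
    · simp [hi, show V.length ≤ j by omega] at h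
    · simp [hj, show V.length ≤ i by omega] at h
    · simp [show V.length ≤ i by omega, show V.length ≤ j by omega]

variable [DecidableEq A]

theorem mem_firstIndices {V : List A} {i : ℕ} :
    i ∈ firstIndices V ↔ i < V.length ∧ ∀ j < i, V[j]? ≠ V[i]? := by
  rw [firstIndices, List.mem_filter, List.mem_range, decide_eq_true_iff]
  simp only [indexPartition, Finset.mem_image, Finset.mem_range]
  refine and_congr_right fun hi => ⟨fun h j hj he => ?_, ?_⟩
  · exact absurd (h _ ⟨i, hi, rfl⟩ (by simp [hi]) j (by simp [he]; omega)) (by omega)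
  · rintro h _ ⟨k, hk, rfl⟩ hik j hj
    simp only [Finset.mem_filter, Finset.mem_range] at hik hj
    by_contra hlt
    exact h j (by omega) (hj.2.trans hik.2.symm)

theorem firstIndices_eq_filter (V : List A) :
    firstIndices V =
      (List.range V.length).filter (fun i => decide (∀ j < i, V[j]? ≠ V[i]?)) := by
  have h : ∀ i ∈ List.range V.length, (decide (∀ j < i, V[j]? ≠ V[i]?)) =
      decide (∀ B ∈ indexPartition V, i ∈ B → ∀ j ∈ B, i ≤ j) := by
    intro i hi
    have h1 := mem_firstIndices (V := V) (i := i)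
    rw [List.mem_range] at hi
    simp only [firstIndices, List.mem_filter, List.mem_range, hi, true_and,
      decide_eq_true_eq] at h1
    exact decide_eq_decide.2 h1.symm
  rw [firstIndices]
  exact (List.filter_congr h).symm

theorem firstIndices_append (V W : List A) :
    firstIndices (V ++ W) = firstIndices V ++
      ((List.range W.length).map (V.length + ·)).filter
        (fun i => decide (∀ j < i, (V ++ W)[j]? ≠ (V ++ W)[i]?)) := by
  rw [firstIndices_eq_filter, firstIndices_eq_filter, List.length_append, List.range_add,
    List.filter_append]
  congr 1
  refine List.filter_congr fun i hi => ?_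
  rw [List.mem_range] at hi
  refine decide_eq_decide.2 (forall₂_congr fun j hj => ?_)
  rw [List.getElem?_append_left (by omega), List.getElem?_append_left (by omega)]

theorem firstIndices_prefix (V W : List A) : firstIndices V <+: firstIndices (V ++ W) := by
  rw [firstIndices_append]
  exact List.prefix_append _ _

theorem nodup_firstIndices (V : List A) : (firstIndices V).Nodup :=
  List.Nodup.filter _ List.nodup_range

theorem exists_mem_firstIndices {V : List A} {i : ℕ} (hi : i < V.length) :
    ∃ j ∈ firstIndices V, V[j]? = V[i]? := by
  classical
  have hex : ∃ j, V[j]? = V[i]? := ⟨i, rfl⟩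
  refine ⟨Nat.find hex, mem_firstIndices.2 ⟨?_, fun j hj he => ?_⟩, Nat.find_spec hex⟩
  · exact (Nat.find_min' hex rfl).trans_lt hi
  · exact Nat.find_min hex hj (he.trans (Nat.find_spec hex))

theorem firstIndices_injOn {V : List A} {i j : ℕ} (hi : i ∈ firstIndices V)
    (hj : j ∈ firstIndices V) (h : V[i]? = V[j]?) : i = j := by
  rw [mem_firstIndices] at hi hj
  rcases lt_trichotomy i j with hlt | rfl | hlt
  · exact absurd h (hj.2 i hlt)
  · rfl
  · exact absurd h.symm (hi.2 j hlt)

theorem SameKer.indexPartition_eq {V W : List A} (h : SameKer V W) :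
    indexPartition V = indexPartition W := by
  simp only [indexPartition, h.1]
  refine Finset.image_congr fun i _ => Finset.filter_congr fun j _ => h.2 j i

theorem SameKer.firstIndices_eq {V W : List A} (h : SameKer V W) :
    firstIndices V = firstIndices W := by
  simp only [firstIndices, h.1, h.indexPartition_eq]

/-- The index partition of a list determines its length and its kernel. -/
theorem sameKer_of_indexPartition_eq {V W : List A} (h : indexPartition V = indexPartition W) :
    SameKer V W := by
  have key : ∀ (X : List A) (i j : ℕ),
      (∃ B ∈ indexPartition X, i ∈ B ∧ j ∈ B) ↔ i < X.length ∧ j < X.length ∧ X[i]? = X[j]? := by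
    intro X i j
    simp only [indexPartition, Finset.mem_image, Finset.mem_range]
    constructor
    · rintro ⟨_, ⟨k, hk, rfl⟩, hi, hj⟩
      simp only [Finset.mem_filter, Finset.mem_range] at hi hj
      exact ⟨hi.1, hj.1, hi.2.trans hj.2.symm⟩
    · rintro ⟨hi, hj, he⟩
      exact ⟨_, ⟨i, hi, rfl⟩, by simp [hi], by simp [hj, he]⟩
  have hlt : ∀ i, i < V.length ↔ i < W.length := by
    intro i
    have h1 := key V i i
    have h2 := key W i i
    rw [h] at h1
    simpa using h1.symm.trans h2
  have hlen : V.length = W.length :=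
    le_antisymm (not_lt.1 fun hh => lt_irrefl _ ((hlt _).1 hh))
      (not_lt.1 fun hh => lt_irrefl _ ((hlt _).2 hh))
  refine ⟨hlen, fun i j => ?_⟩
  by_cases hi : i < V.length <;> by_cases hj : j < V.length
  · have h1 := key V i j
    have h2 := key W i j
    rw [h] at h1
    simpa [hi, hj, (hlt i).1 hi, (hlt j).1 hj] using h1.symm.trans h2
  · simp [hi, show V.length ≤ j by omega, show W.length ≤ j by omega, (hlt i).1 hi]
  · simp [hj, show V.length ≤ i by omega, show W.length ≤ i by omega, (hlt j).1 hj]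
  · simp [show V.length ≤ i by omega, show V.length ≤ j by omega, show W.length ≤ i by omega,
      show W.length ≤ j by omega]

theorem firstIndices_concat (V : List A) (v : A) :
    firstIndices (V ++ [v]) = firstIndices V ++ if v ∈ V then [] else [V.length] := by
  rw [firstIndices_append]
  congr 1
  have h : (∀ j < V.length, (V ++ [v])[j]? ≠ (V ++ [v])[V.length]?) ↔ v ∉ V := by
    rw [List.mem_iff_getElem?, not_exists, List.getElem?_concat_length]
    constructor
    · intro hh j hj
      have hj' : j < V.length := (List.getElem?_eq_some_iff.1 hj).1
      exact hh j hj' (by rw [List.getElem?_append_left hj', hj])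
    · intro hh j hj
      rw [List.getElem?_append_left hj]
      exact hh j
  by_cases hv : v ∈ V
  · have := mt h.1 (not_not.2 hv)
    simp only [List.length_singleton, List.range_one, List.map_cons, List.map_nil,
      add_zero, hv, if_true]
    rw [List.filter_eq_nil_iff]
    simpa using this
  · have := h.2 hv
    simp only [List.length_singleton, List.range_one, List.map_cons, List.map_nil,
      add_zero, hv, if_false]
    rw [List.filter_eq_self]
    simpa using this

theorem indexPartition_concat_of_notMem {V : List A} {v : A} (hv : v ∉ V) :
    indexPartition (V ++ [v]) = insert {V.length} (indexPartition V) := by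
  have hne : ∀ j, V[j]? ≠ some v := fun j hj => hv (List.mem_of_getElem? hj)
  simp only [indexPartition, List.length_append, List.length_singleton, Finset.range_add_one,
    Finset.image_insert]
  congr 1
  · ext j
    simp only [Finset.mem_filter, Finset.mem_insert, Finset.mem_range, Finset.mem_singleton,
      List.getElem?_concat_length]
    constructor
    · rintro ⟨rfl | hj, h⟩
      · rfl
      · rw [List.getElem?_append_left hj] at h
        exact absurd h (hne j)
    · rintro rfl
      simp
  · refine Finset.image_congr fun i hi => ?_
    have hi : i < V.length := by simpa using hi
    ext j
    simp only [Finset.mem_filter, Finset.mem_insert, Finset.mem_range]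
    rw [List.getElem?_append_left hi]
    constructor
    · rintro ⟨rfl | hj, h⟩
      · rw [List.getElem?_concat_length] at h
        exact absurd h.symm (hne i)
      · rw [List.getElem?_append_left hj] at h
        exact ⟨hj, h⟩
    · rintro ⟨hj, h⟩
      exact ⟨Or.inr hj, by rw [List.getElem?_append_left hj, h]⟩

theorem indexPartition_concat_of_getElem? {V : List A} {v : A} {k : ℕ} (hk : V[k]? = some v) :
    indexPartition (V ++ [v]) =
      (indexPartition V).image (fun B => if k ∈ B then insert V.length B else B) := by
  have hkl : k < V.length := (List.getElem?_eq_some_iff.1 hk).1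
  have hblk : ∀ i, i < V.length →
      ({j ∈ Finset.range (V.length + 1) | (V ++ [v])[j]? = (V ++ [v])[i]?} : Finset ℕ) =
      (if k ∈ ({j ∈ Finset.range V.length | V[j]? = V[i]?} : Finset ℕ) then
        insert V.length ({j ∈ Finset.range V.length | V[j]? = V[i]?} : Finset ℕ)
        else ({j ∈ Finset.range V.length | V[j]? = V[i]?} : Finset ℕ)) := by
    intro i hi
    rw [List.getElem?_append_left hi]
    have h1 : ∀ j, j < V.length → (V ++ [v])[j]? = V[j]? :=
      fun j hj => List.getElem?_append_left hj
    ext j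
    simp only [Finset.mem_filter, Finset.mem_range, hkl, true_and, hk]
    rcases lt_trichotomy j V.length with hj | rfl | hj
    · split_ifs <;> simp [hj, hj.ne, Nat.lt_succ_of_lt hj]
    · split_ifs with hc <;> simp [hc]
    · split_ifs <;> simp <;> omega
  simp only [indexPartition, List.length_append, List.length_singleton, Finset.image_image]
  rw [Finset.range_add_one, Finset.image_insert, ← Finset.range_add_one]
  rw [Finset.insert_eq_of_mem]
  · refine Finset.image_congr fun i hi => hblk i (by simpa using hi)
  · refine Finset.mem_image.2 ⟨k, by simpa using hkl, ?_⟩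
    rw [List.getElem?_append_left hkl, hk, List.getElem?_concat_length]

end Kernel

/-! ### Partial isomorphisms -/

section PartialIso

variable {L : Language} {A : Type*} [L.Structure A]

/-- A subisomorphism whose domain is allowed to be empty. -/
structure IsPartialIso (L : Language) {A : Type*} [L.Structure A] (γ : PartialMap A) : Prop where
  injOn : Set.InjOn γ.toFun γ.dom
  closed : ∀ (r : ℕ) (f : L.Functions r), Language.ClosedUnder f γ.dom
  map_fun : ∀ (r : ℕ) (f : L.Functions r) (x : Fin r → A), (∀ i, x i ∈ γ.dom) →
    γ.toFun (Language.Structure.funMap f x) = Language.Structure.funMap f (fun i => γ.toFun (x i))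

theorem IsPartialIso.isSubisomorphism {γ : PartialMap A} (h : IsPartialIso L γ)
    (hne : γ.dom.Nonempty) : IsSubisomorphism L γ :=
  ⟨h.injOn, hne, h.closed, fun r f x y hx _ hxy => by rw [← hxy, h.map_fun r f x hx]⟩

theorem isPartialIso_id : IsPartialIso L (⟨Set.univ, id⟩ : PartialMap A) :=
  ⟨Function.injective_id.injOn, fun _ _ _ _ => trivial, fun _ _ _ _ => rfl⟩

/-- The inverse of a partial map that is injective on its domain, defined on the image. -/
noncomputable def PartialMap.inv [Nonempty A] (γ : PartialMap A) : PartialMap A :=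
  ⟨γ.toFun '' γ.dom, Function.invFunOn γ.toFun γ.dom⟩

/-- The composition of partial maps, with the largest domain on which it makes sense. -/
def PartialMap.comp (δ γ : PartialMap A) : PartialMap A :=
  ⟨{x | x ∈ γ.dom ∧ γ.toFun x ∈ δ.dom}, fun x => δ.toFun (γ.toFun x)⟩

theorem IsPartialIso.inv_apply [Nonempty A] {γ : PartialMap A} (h : IsPartialIso L γ) {x : A}
    (hx : x ∈ γ.dom) : γ.inv.toFun (γ.toFun x) = x :=
  h.injOn.leftInvOn_invFunOn hx

theorem IsPartialIso.inv [Nonempty A] {γ : PartialMap A} (h : IsPartialIso L γ) :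
    IsPartialIso L γ.inv where
  injOn := by
    rintro _ ⟨x, hx, rfl⟩ _ ⟨y, hy, rfl⟩ hxy
    rw [h.inv_apply hx, h.inv_apply hy] at hxy
    rw [hxy]
  closed r f x hx := by
    choose y hy hyx using hx
    obtain rfl : (fun i => γ.toFun (y i)) = x := funext hyx
    exact ⟨_, h.closed r f y hy, h.map_fun r f y hy⟩
  map_fun r f x hx := by
    choose y hy hyx using hx
    obtain rfl : (fun i => γ.toFun (y i)) = x := funext hyx
    rw [← h.map_fun r f y hy, h.inv_apply (h.closed r f y hy)]
    simp only [h.inv_apply (hy _)]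

theorem IsPartialIso.comp {δ γ : PartialMap A} (hδ : IsPartialIso L δ) (hγ : IsPartialIso L γ) :
    IsPartialIso L (δ.comp γ) where
  injOn _ hx _ hy hxy := hγ.injOn hx.1 hy.1 (hδ.injOn hx.2 hy.2 hxy)
  closed r f x hx := ⟨hγ.closed r f x fun i => (hx i).1, by
    rw [hγ.map_fun r f x fun i => (hx i).1]
    exact hδ.closed r f _ fun i => (hx i).2⟩
  map_fun r f x hx := by
    simp only [PartialMap.comp]
    rw [hγ.map_fun r f x fun i => (hx i).1, hδ.map_fun r f _ fun i => (hx i).2]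

/-- The subuniverse generated by the entries of a tuple. -/
def gen (L : Language) {A : Type*} [L.Structure A] (a : List A) : Set A :=
  (Language.Substructure.closure L {x | x ∈ a} : L.Substructure A)

theorem mem_gen_of_mem {a : List A} {x : A} (hx : x ∈ a) : x ∈ gen L a :=
  Language.Substructure.subset_closure (L := L) (s := {x | x ∈ a}) hx

theorem gen_closed (a : List A) (r : ℕ) (f : L.Functions r) :
    Language.ClosedUnder f (gen L a) :=
  Language.Substructure.fun_mem _ f

theorem gen_subset {a : List A} {D : Set A} (ha : ∀ x ∈ a, x ∈ D)
    (hD : ∀ (r : ℕ) (f : L.Functions r), Language.ClosedUnder f D) : gen L a ⊆ D :=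
  (Language.Substructure.closure_le (L := L) (S := ⟨D, fun {r} f => hD r f⟩)).2 ha

theorem gen_map {γ : PartialMap A} (h : IsPartialIso L γ) {a : List A}
    (ha : ∀ x ∈ a, x ∈ γ.dom) : gen L (a.map γ.toFun) = γ.toFun '' gen L a := by
  have hsub : gen L a ⊆ γ.dom := gen_subset ha h.closed
  apply Set.Subset.antisymm
  · refine gen_subset (fun x hx => ?_) fun r f x hx => ?_
    · obtain ⟨y, hy, rfl⟩ := List.mem_map.1 hx
      exact ⟨y, mem_gen_of_mem hy, rfl⟩
    · choose y hy hyx using hx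
      obtain rfl : (fun i => γ.toFun (y i)) = x := funext hyx
      exact ⟨_, gen_closed a r f y hy, h.map_fun r f y fun i => hsub (hy i)⟩
  · have : gen L a ⊆ {x | x ∈ γ.dom ∧ γ.toFun x ∈ gen L (a.map γ.toFun)} := by
      refine gen_subset (fun x hx => ⟨ha x hx, mem_gen_of_mem (List.mem_map_of_mem hx)⟩)
        fun r f x hx => ⟨h.closed r f x fun i => (hx i).1, ?_⟩
      rw [h.map_fun r f x fun i => (hx i).1]
      exact gen_closed _ r f _ fun i => (hx i).2
    rintro _ ⟨x, hx, rfl⟩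
    exact (this hx).2

/-- A partial isomorphism is determined on a subuniverse by its values at generators. -/
theorem eqOn_gen {γ δ : PartialMap A} (hγ : IsPartialIso L γ) (hδ : IsPartialIso L δ) {a : List A}
    (haγ : ∀ x ∈ a, x ∈ γ.dom) (haδ : ∀ x ∈ a, x ∈ δ.dom)
    (h : a.map γ.toFun = a.map δ.toFun) {x : A} (hx : x ∈ gen L a) : γ.toFun x = δ.toFun x := by
  have : gen L a ⊆ {x | (x ∈ γ.dom ∧ x ∈ δ.dom) ∧ γ.toFun x = δ.toFun x} := by
    refine gen_subset (fun x hx => ⟨⟨haγ x hx, haδ x hx⟩, List.map_inj_left.1 h x hx⟩)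
      fun r f x hx => ⟨⟨hγ.closed r f x fun i => (hx i).1.1, hδ.closed r f x fun i => (hx i).1.2⟩,
        ?_⟩
    rw [hγ.map_fun r f x fun i => (hx i).1.1, hδ.map_fun r f x fun i => (hx i).1.2]
    simp only [(hx _).2]
  exact (this hx).2

/-- Isomorphic tuples: some partial isomorphism takes the one to the other. -/
def Isomorphic (L : Language) {A : Type*} [L.Structure A] (a b : List A) : Prop :=
  ∃ γ : PartialMap A, IsPartialIso L γ ∧ (∀ x ∈ a, x ∈ γ.dom) ∧ a.map γ.toFun = b

theorem IsPartialIso.map_inv [Nonempty A] {γ : PartialMap A} (h : IsPartialIso L γ) {a : List A}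
    (ha : ∀ x ∈ a, x ∈ γ.dom) : (a.map γ.toFun).map γ.inv.toFun = a := by
  rw [List.map_map]
  exact (List.map_congr_left fun x hx => h.inv_apply (ha x hx)).trans (List.map_id a)

theorem Isomorphic.symm [Nonempty A] {a b : List A} (h : Isomorphic L a b) :
    Isomorphic L b a := by
  obtain ⟨γ, hγ, ha, rfl⟩ := h
  refine ⟨γ.inv, hγ.inv, fun x hx => ?_, hγ.map_inv ha⟩
  obtain ⟨y, hy, rfl⟩ := List.mem_map.1 hx
  exact ⟨y, ha y hy, rfl⟩

theorem Isomorphic.trans {a b c : List A} (h : Isomorphic L a b) (h' : Isomorphic L b c) :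
    Isomorphic L a c := by
  obtain ⟨γ, hγ, ha, rfl⟩ := h
  obtain ⟨δ, hδ, hb, rfl⟩ := h'
  exact ⟨δ.comp γ, hδ.comp hγ, fun x hx => ⟨ha x hx, hb _ (List.mem_map_of_mem hx)⟩,
    by rw [List.map_map]; rfl⟩

theorem Isomorphic.ncard_gen {a b : List A} (h : Isomorphic L a b) :
    (gen L a).ncard = (gen L b).ncard := by
  obtain ⟨γ, hγ, ha, rfl⟩ := h
  rw [gen_map hγ ha, (hγ.injOn.mono (gen_subset ha hγ.closed)).ncard_image]

end PartialIso

/-! ### Runs of `IsoType` -/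

section Runs

variable {L : Language} {A : Type*} [L.Structure A] [Nonempty A]

/-- An evaluation performed by `IsoType`: an operation symbol and the indices of its arguments. -/
abbrev Instr (L : Language) := Σ r, L.Functions r × (Fin r → ℕ)

/-- The evaluations performed in a pass of `IsoType` entered with the lists `H` and `N`. -/
def instrs (τ : Vocabulary L) (H N : List ℕ) : List (Instr L) :=
  τ.arities.flatMap fun r => (τ.op r).flatMap fun f =>
    (newTuples H N r).map fun l => ⟨r, f, l⟩

/-- The value of an evaluation whose indices refer to the list `V`. -/
noncomputable def evalInstr (V : List A) (i : Instr L) : A :=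
  Language.Structure.funMap i.2.1 fun j => V.getD (i.2.2 j) (Classical.arbitrary A)

theorem evalInstr_append {V : List A} (W : List A) {i : Instr L} (h : ∀ j, i.2.2 j < V.length) :
    evalInstr (V ++ W) i = evalInstr V i := by
  simp only [evalInstr, List.getD_append _ _ _ _ (h _)]

variable [DecidableEq A]

/-- The components `P` and `H` of the state are the index partition and the list of the first
occurrences belonging to the component `V`. -/
def IsoState.Consistent (s : IsoState A) : Prop :=
  s.P = indexPartition s.V ∧ s.H = firstIndices s.V

theorem isoBody_spec {r : ℕ} (f : L.Functions r) {s : IsoState A} (hs : s.Consistent)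
    (l : Fin r → ℕ) :
    (isoBody f s l).V = s.V ++ [evalInstr s.V ⟨r, f, l⟩] ∧ (isoBody f s l).N = s.N ∧
      (isoBody f s l).Consistent := by
  obtain ⟨hP, hH⟩ := hs
  have hv : evalInstr s.V ⟨r, f, l⟩ = Language.Structure.funMap f (fun i => s.val (l i)) := rfl
  rw [hv]
  generalize hval : Language.Structure.funMap f (fun i => s.val (l i)) = v
  have hget : ∀ i ∈ s.H, s.V[i]? = some (s.val i) := by
    intro i hi
    rw [hH, mem_firstIndices] at hi
    simp [IsoState.val, hi.1]
  simp only [isoBody, hval]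
  cases hf : s.H.find? (fun j => decide (s.val j = v)) with
  | some j =>
    have hj := List.mem_of_find?_eq_some hf
    have hjv : s.val j = v := by simpa using List.find?_some hf
    have hk : s.V[j]? = some v := hjv ▸ hget j hj
    refine ⟨rfl, rfl, ?_, ?_⟩
    · simp only [hP, indexPartition_concat_of_getElem? hk]
    · simp only [firstIndices_concat, List.mem_of_getElem? hk, if_true, List.append_nil, hH]
  | none =>
    rw [List.find?_eq_none] at hf
    have hv : v ∉ s.V := by
      intro hmem
      obtain ⟨i, hi, hiv⟩ := List.mem_iff_getElem.1 hmem
      obtain ⟨j, hj, hji⟩ := exists_mem_firstIndices hi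
      rw [← hH] at hj
      refine hf j hj ?_
      rw [hget j hj, List.getElem?_eq_getElem hi, Option.some.injEq, hiv] at hji
      simpa using hji
    refine ⟨rfl, rfl, ?_, ?_⟩
    · simp only [hP, indexPartition_concat_of_notMem hv]
    · simp only [firstIndices_concat, hv, if_false, hH]

theorem foldl_isoBody (is : List (Instr L)) {s : IsoState A} (hs : s.Consistent)
    (his : ∀ i ∈ is, ∀ j, i.2.2 j < s.V.length) :
    (is.foldl (fun s i => isoBody i.2.1 s i.2.2) s).V = s.V ++ is.map (evalInstr s.V) ∧
      (is.foldl (fun s i => isoBody i.2.1 s i.2.2) s).Consistent := by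
  induction is generalizing s with
  | nil => simpa using hs
  | cons i is ih =>
    obtain ⟨hV, -, hc⟩ := isoBody_spec i.2.1 hs i.2.2
    have hlt : ∀ i' ∈ is, ∀ j, i'.2.2 j < s.V.length :=
      fun i' hi' => his i' (List.mem_cons_of_mem _ hi')
    obtain ⟨h1, h2⟩ := ih hc fun i' hi' j => by
      rw [hV, List.length_append]; exact Nat.lt_add_right _ (hlt i' hi' j)
    refine ⟨?_, h2⟩
    rw [List.foldl_cons, h1, hV, List.append_assoc, List.map_cons, List.singleton_append]
    congr 2
    exact List.map_congr_left fun i' hi' => evalInstr_append _ (hlt i' hi')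

theorem mem_tuplesOver {H : List ℕ} {r : ℕ} {l : Fin r → ℕ} :
    l ∈ tuplesOver H r ↔ ∀ i, l i ∈ H := by
  induction r with
  | zero => simp [tuplesOver, Subsingleton.elim l Fin.elim0]
  | succ r ih =>
    simp only [tuplesOver, List.mem_flatMap, List.mem_map, ih]
    constructor
    · rintro ⟨x, hx, l', hl', rfl⟩
      exact Fin.cases (by simpa using hx) (by simpa using hl')
    · intro h
      exact ⟨l 0, h 0, Fin.tail l, fun i => h i.succ, Fin.cons_self_tail l⟩

theorem mem_instrs (τ : Vocabulary L) {H N : List ℕ} {i : Instr L} :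
    i ∈ instrs τ H N ↔ (∀ j, i.2.2 j ∈ H) ∧ ∃ j, i.2.2 j ∈ N := by
  obtain ⟨r, f, l⟩ := i
  simp only [instrs, List.mem_flatMap, List.mem_map, newTuples, List.mem_filter, mem_tuplesOver,
    decide_eq_true_eq]
  constructor
  · rintro ⟨r', -, f', -, l', hl', h⟩
    cases h
    exact hl'
  · intro h
    exact ⟨r, (τ.mem_arities r).2 ⟨f⟩, f, τ.mem_op r f, l, h, rfl⟩

theorem isoPass_eq (τ : Vocabulary L) (s : IsoState A) :
    isoPass τ s =
      let s' := (instrs τ s.H s.N).foldl (fun s i => isoBody i.2.1 s i.2.2) s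
      { V := s'.V, P := s'.P, H := s'.H, N := s'.H.filter (fun l => decide (l ∉ s.H)) } := by
  simp only [isoPass, instrs, List.foldl_flatMap, List.foldl_map]

theorem isoPass_spec (τ : Vocabulary L) {s : IsoState A} (hs : s.Consistent) :
    (isoPass τ s).V = s.V ++ (instrs τ s.H s.N).map (evalInstr s.V) ∧
      (isoPass τ s).N = (isoPass τ s).H.filter (fun l => decide (l ∉ s.H)) ∧
      (isoPass τ s).Consistent := by
  rw [isoPass_eq]
  obtain ⟨h1, h2⟩ := foldl_isoBody (instrs τ s.H s.N) hs fun i hi j => by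
    have := ((mem_instrs τ).1 hi).1 j
    rw [hs.2, mem_firstIndices] at this
    exact this.1
  exact ⟨h1, rfl, h2⟩

/-- The state of `IsoType` after `j` passes. -/
noncomputable def isoRun (τ : Vocabulary L) (a : List A) (j : ℕ) : IsoState A :=
  (isoPass τ)^[j] (isoInit a)

theorem isoRun_succ (τ : Vocabulary L) (a : List A) (j : ℕ) :
    isoRun τ a (j + 1) = isoPass τ (isoRun τ a j) :=
  Function.iterate_succ_apply' _ _ _

theorem isoRun_consistent (τ : Vocabulary L) (a : List A) (j : ℕ) :
    (isoRun τ a j).Consistent := by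
  induction j with
  | zero => exact ⟨rfl, rfl⟩
  | succ j ih => rw [isoRun_succ]; exact (isoPass_spec τ ih).2.2

theorem isoRun_V_succ (τ : Vocabulary L) (a : List A) (j : ℕ) :
    (isoRun τ a (j + 1)).V = (isoRun τ a j).V ++
      (instrs τ (isoRun τ a j).H (isoRun τ a j).N).map (evalInstr (isoRun τ a j).V) := by
  rw [isoRun_succ]; exact (isoPass_spec τ (isoRun_consistent τ a j)).1

theorem isoRun_N_succ (τ : Vocabulary L) (a : List A) (j : ℕ) :
    (isoRun τ a (j + 1)).N =
      (isoRun τ a (j + 1)).H.filter (fun l => decide (l ∉ (isoRun τ a j).H)) := by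
  rw [isoRun_succ]; exact (isoPass_spec τ (isoRun_consistent τ a j)).2.1

theorem isoRun_V_prefix (τ : Vocabulary L) (a : List A) {i j : ℕ} (hij : i ≤ j) :
    (isoRun τ a i).V <+: (isoRun τ a j).V := by
  induction j, hij using Nat.le_induction with
  | base => exact List.prefix_rfl
  | succ j _ ih => exact ih.trans (isoRun_V_succ τ a j ▸ List.prefix_append _ _)

theorem isoRun_H_prefix (τ : Vocabulary L) (a : List A) (j : ℕ) :
    (isoRun τ a j).H <+: (isoRun τ a (j + 1)).H := by
  rw [(isoRun_consistent τ a j).2, (isoRun_consistent τ a (j + 1)).2, isoRun_V_succ]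
  exact firstIndices_prefix _ _

theorem mem_isoRun_H_lt {τ : Vocabulary L} {a : List A} {j i : ℕ} (hi : i ∈ (isoRun τ a j).H) :
    i < (isoRun τ a j).V.length := by
  rw [(isoRun_consistent τ a j).2, mem_firstIndices] at hi
  exact hi.1

/-- The indices that are not new after a pass are those known before. -/
theorem isoRun_old (τ : Vocabulary L) (a : List A) (j : ℕ) :
    (isoRun τ a (j + 1)).H.filter (fun l => decide (l ∉ (isoRun τ a (j + 1)).N)) =
      (isoRun τ a j).H := by
  obtain ⟨X, hX⟩ := isoRun_H_prefix τ a j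
  have hnd : (isoRun τ a (j + 1)).H.Nodup := by
    rw [(isoRun_consistent τ a (j + 1)).2]; exact nodup_firstIndices _
  rw [isoRun_N_succ, ← hX]
  rw [← hX] at hnd
  rw [List.filter_append, List.filter_eq_self.2, List.filter_eq_nil_iff.2, List.append_nil]
  · intro x hx
    have : x ∉ (isoRun τ a j).H := fun h => (List.disjoint_of_nodup_append hnd) h hx
    simp [this, hx]
  · intro x hx
    simp [hx]

end Runs

/-! ### The result of `IsoType` -/

section Result

variable {L : Language} {A : Type*} [L.Structure A] [Nonempty A] [DecidableEq A]

/-- The evaluations performed in the first `j` passes. -/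
noncomputable def isoLog (τ : Vocabulary L) (a : List A) (j : ℕ) : List (Instr L) :=
  (List.range j).flatMap fun i => instrs τ (isoRun τ a i).H (isoRun τ a i).N

theorem isoLog_succ (τ : Vocabulary L) (a : List A) (j : ℕ) :
    isoLog τ a (j + 1) = isoLog τ a j ++ instrs τ (isoRun τ a j).H (isoRun τ a j).N := by
  simp [isoLog, List.range_succ]

theorem lt_of_mem_instrs {τ : Vocabulary L} {a : List A} {j : ℕ} {i : Instr L}
    (hi : i ∈ instrs τ (isoRun τ a j).H (isoRun τ a j).N) (k : Fin i.1) :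
    i.2.2 k < (isoRun τ a j).V.length :=
  mem_isoRun_H_lt (((mem_instrs τ).1 hi).1 k)

theorem lt_of_mem_isoLog {τ : Vocabulary L} {a : List A} {j : ℕ} {i : Instr L}
    (hi : i ∈ isoLog τ a j) (k : Fin i.1) : i.2.2 k < (isoRun τ a j).V.length := by
  obtain ⟨j', hj', hi⟩ := List.mem_flatMap.1 hi
  exact (lt_of_mem_instrs hi k).trans_le
    (isoRun_V_prefix τ a (List.mem_range.1 hj').le).length_le

/-- The list `V` consists of the input and the values of the logged evaluations. -/
theorem isoRun_V_eq (τ : Vocabulary L) (a : List A) (j : ℕ) :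
    (isoRun τ a j).V = a ++ (isoLog τ a j).map (evalInstr (isoRun τ a j).V) := by
  induction j with
  | zero => simp [isoLog, isoRun, isoInit]
  | succ j ih =>
    have h1 : ∀ i ∈ isoLog τ a j, evalInstr (isoRun τ a (j + 1)).V i =
        evalInstr (isoRun τ a j).V i := fun i hi => by
      rw [isoRun_V_succ, evalInstr_append _ (lt_of_mem_isoLog hi)]
    have h2 : ∀ i ∈ instrs τ (isoRun τ a j).H (isoRun τ a j).N,
        evalInstr (isoRun τ a (j + 1)).V i = evalInstr (isoRun τ a j).V i := fun i hi => by
      rw [isoRun_V_succ, evalInstr_append _ (lt_of_mem_instrs hi)]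
    rw [isoLog_succ, List.map_append, List.map_congr_left h1, List.map_congr_left h2,
      ← List.append_assoc, ← ih, ← isoRun_V_succ]

/-- All evaluations at indices that are not new have been performed. -/
theorem mem_isoLog [IsEmpty L.Constants] (τ : Vocabulary L) (a : List A) (j : ℕ) (i : Instr L)
    (hi : ∀ k, i.2.2 k ∈ (isoRun τ a j).H ∧ i.2.2 k ∉ (isoRun τ a j).N) :
    i ∈ isoLog τ a j := by
  induction j with
  | zero =>
    obtain ⟨r, f, l⟩ := i
    cases r with
    | zero => exact isEmptyElim (α := L.Constants) f
    | succ r => exact absurd (hi 0).1 (hi 0).2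
  | succ j ih =>
    have hH : ∀ k, i.2.2 k ∈ (isoRun τ a j).H := fun k => by
      rw [← isoRun_old]
      simpa using hi k
    rw [isoLog_succ, List.mem_append, mem_instrs]
    by_cases hN : ∃ k, i.2.2 k ∈ (isoRun τ a j).N
    · exact Or.inr ⟨hH, hN⟩
    · exact Or.inl (ih fun k => ⟨hH k, fun hk => hN ⟨k, hk⟩⟩)

/-- The number of evaluations whose arguments are taken from a set of `h` elements. -/
def evalCount (τ : Vocabulary L) (h : ℕ) : ℕ :=
  (τ.arities.map fun r => (τ.op r).length * h ^ r).sum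

theorem length_tuplesOver (H : List ℕ) (r : ℕ) : (tuplesOver H r).length = H.length ^ r := by
  induction r with
  | zero => simp [tuplesOver]
  | succ r ih => simp [tuplesOver, List.length_flatMap, ih, pow_succ, mul_comm]

theorem tuplesOver_filter (H N : List ℕ) (r : ℕ) :
    (tuplesOver H r).filter (fun l => !decide (∃ j, l j ∈ N)) =
      tuplesOver (H.filter fun x => decide (x ∉ N)) r := by
  induction r with
  | zero => simp [tuplesOver]
  | succ r ih =>
    simp only [tuplesOver, List.filter_flatMap, List.filter_map, ← ih]
    clear ih
    generalize tuplesOver H r = T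
    induction H with
    | nil => rfl
    | cons x H ihH =>
      by_cases hx : x ∈ N
      · simpa [Fin.exists_fin_succ, hx, Function.comp_def] using ihH
      · simpa [Fin.exists_fin_succ, hx, Function.comp_def] using ihH

theorem length_newTuples (H N : List ℕ) (r : ℕ) :
    (newTuples H N r).length + (H.filter fun x => decide (x ∉ N)).length ^ r = H.length ^ r := by
  rw [← length_tuplesOver, ← length_tuplesOver, ← tuplesOver_filter, newTuples,
    ← List.length_eq_length_filter_add]

theorem length_instrs (τ : Vocabulary L) (H N : List ℕ) :
    (instrs τ H N).length + evalCount τ (H.filter fun x => decide (x ∉ N)).length =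
      evalCount τ H.length := by
  simp only [instrs, evalCount, List.length_flatMap, List.length_map, List.map_const',
    List.sum_replicate, smul_eq_mul]
  rw [← List.sum_map_add]
  simp only [← mul_add, length_newTuples]

theorem length_isoLog [IsEmpty L.Constants] (τ : Vocabulary L) (a : List A) (j : ℕ) :
    (isoLog τ a j).length =
      evalCount τ ((isoRun τ a j).H.filter fun x => decide (x ∉ (isoRun τ a j).N)).length := by
  induction j with
  | zero =>
    have h0 : (isoRun τ a 0).H.filter (fun x => decide (x ∉ (isoRun τ a 0).N)) = [] :=
      List.filter_eq_nil_iff.2 fun x hx => by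
        have : x ∈ (isoRun τ a 0).N := hx
        simpa using this
    rw [h0, eq_comm, evalCount]
    refine List.sum_eq_zero fun x hx => ?_
    obtain ⟨r, hr, rfl⟩ := List.mem_map.1 hx
    rcases Nat.eq_zero_or_pos r with rfl | hr0
    · obtain ⟨f⟩ := (τ.mem_arities 0).1 hr
      exact isEmptyElim (α := L.Constants) f
    · simp [hr0.ne']
  | succ j ih =>
    rw [isoLog_succ, List.length_append, ih, isoRun_old, add_comm, length_instrs]

theorem isoTypeReturns_iff {τ : Vocabulary L} {a : List A} {P : Finset (Finset ℕ)} {U : List A} :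
    IsoTypeReturns τ a P U ↔ ∃ m, (∀ j < m, (isoRun τ a j).N ≠ []) ∧ (isoRun τ a m).N = [] ∧
      P = (isoRun τ a m).P ∧ U = (isoRun τ a m).H.map (isoRun τ a m).val := Iff.rfl

theorem IsoTypeReturns.unique {τ : Vocabulary L} {a : List A} {P P' : Finset (Finset ℕ)}
    {U U' : List A} (h : IsoTypeReturns τ a P U) (h' : IsoTypeReturns τ a P' U') :
    P = P' ∧ U = U' := by
  obtain ⟨m, h1, h2, rfl, rfl⟩ := isoTypeReturns_iff.1 h
  obtain ⟨m', h1', h2', rfl, rfl⟩ := isoTypeReturns_iff.1 h'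
  obtain rfl : m = m' := by
    rcases lt_trichotomy m m' with hlt | rfl | hlt
    · exact absurd h2 (h1' m hlt)
    · rfl
    · exact absurd h2' (h1 m' hlt)
  exact ⟨rfl, rfl⟩

theorem map_val_eq {τ : Vocabulary L} {a : List A} {m : ℕ} :
    ∀ i ∈ (isoRun τ a m).H, (isoRun τ a m).V[i]? = some ((isoRun τ a m).val i) := by
  intro i hi
  simp [IsoState.val, mem_isoRun_H_lt hi]

theorem nodup_map_val (τ : Vocabulary L) (a : List A) (m : ℕ) :
    ((isoRun τ a m).H.map (isoRun τ a m).val).Nodup := by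
  have hH := (isoRun_consistent τ a m).2
  refine List.Nodup.map_on (fun i hi j hj hij => ?_) (hH ▸ nodup_firstIndices _)
  have hi' := map_val_eq i hi
  have hj' := map_val_eq j hj
  rw [hH] at hi hj
  exact firstIndices_injOn hi hj (by rw [hi', hj', hij])

theorem mem_map_val {τ : Vocabulary L} {a : List A} {m : ℕ} {x : A} :
    x ∈ (isoRun τ a m).H.map (isoRun τ a m).val ↔ x ∈ (isoRun τ a m).V := by
  constructor
  · intro hx
    obtain ⟨i, hi, rfl⟩ := List.mem_map.1 hx
    exact List.mem_of_getElem? (map_val_eq i hi)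
  · intro hx
    obtain ⟨i, hi, rfl⟩ := List.mem_iff_getElem.1 hx
    obtain ⟨j, hj, hji⟩ := exists_mem_firstIndices hi
    rw [← (isoRun_consistent τ a m).2] at hj
    rw [map_val_eq j hj, List.getElem?_eq_getElem hi, Option.some.injEq] at hji
    exact List.mem_map.2 ⟨j, hj, hji⟩

/-- As the number of known elements grows with each pass, `IsoType` halts. -/
theorem exists_isoTypeReturns [Fintype A] (τ : Vocabulary L) (a : List A) :
    ∃ P U, IsoTypeReturns τ a P U := by
  classical
  have hex : ∃ m, (isoRun τ a m).N = [] := by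
    by_contra! hne
    have hlen : ∀ j, j ≤ (isoRun τ a j).H.length := by
      intro j
      induction j with
      | zero => exact Nat.zero_le _
      | succ j ih =>
        obtain ⟨X, hX⟩ := isoRun_H_prefix τ a j
        have hX0 : X ≠ [] := by
          rintro rfl
          refine hne (j + 1) ?_
          rw [isoRun_N_succ, List.filter_eq_nil_iff]
          intro x hx
          rw [← hX, List.append_nil] at hx
          simpa using hx
        rw [← hX, List.length_append]
        have := List.length_pos_iff.2 hX0
        omega
    have h1 := (nodup_map_val τ a (Fintype.card A + 1)).length_le_card
    rw [List.length_map] at h1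
    exact absurd (hlen (Fintype.card A + 1)) (by omega)
  exact ⟨_, _, Nat.find hex, fun j hj => Nat.find_min hex hj, Nat.find_spec hex, rfl, rfl⟩

theorem isoRun_N_congr {τ : Vocabulary L} {a b : List A} {j : ℕ}
    (h : ∀ i ≤ j, (isoRun τ a i).H = (isoRun τ b i).H) : (isoRun τ a j).N = (isoRun τ b j).N := by
  cases j with
  | zero => exact h 0 le_rfl
  | succ j => rw [isoRun_N_succ, isoRun_N_succ, h _ le_rfl, h _ (Nat.le_succ j)]

/-- If the partitions returned agree, then the two runs perform the same evaluations. -/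
theorem isoLog_congr {τ : Vocabulary L} {a b : List A} {m : ℕ} (hab : a.length = b.length)
    {V W : List A} (hV : (isoRun τ a m).V <+: V) (hW : (isoRun τ b m).V <+: W)
    (hVW : SameKer V W) :
    isoLog τ a m = isoLog τ b m ∧ SameKer (isoRun τ a m).V (isoRun τ b m).V ∧
      ∀ i ≤ m, (isoRun τ a i).H = (isoRun τ b i).H := by
  induction m with
  | zero =>
    have hk : SameKer (isoRun τ a 0).V (isoRun τ b 0).V := hVW.of_prefix hV hW hab
    refine ⟨rfl, hk, fun i hi => ?_⟩
    obtain rfl := Nat.le_zero.1 hi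
    exact hk.firstIndices_eq
  | succ m ih =>
    obtain ⟨h1, h2, h3⟩ := ih ((isoRun_V_prefix τ a m.le_succ).trans hV)
      ((isoRun_V_prefix τ b m.le_succ).trans hW)
    have hlog : isoLog τ a (m + 1) = isoLog τ b (m + 1) := by
      rw [isoLog_succ, isoLog_succ, h1, h3 m le_rfl, isoRun_N_congr h3]
    have hk : SameKer (isoRun τ a (m + 1)).V (isoRun τ b (m + 1)).V := by
      refine hVW.of_prefix hV hW ?_
      rw [isoRun_V_eq, isoRun_V_eq τ b, List.length_append, List.length_append, List.length_map,
        List.length_map, hab, hlog]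
    refine ⟨hlog, hk, fun i hi => ?_⟩
    rcases hi.lt_or_eq with hi | rfl
    · exact h3 i (Nat.lt_succ_iff.1 hi)
    · rw [(isoRun_consistent τ a _).2, (isoRun_consistent τ b _).2, hk.firstIndices_eq]

/-- The number of values in a halted run is determined by the lengths of the input and of the
list `H`. -/
theorem length_isoRun_V [IsEmpty L.Constants] {τ : Vocabulary L} {a : List A} {m : ℕ}
    (hN : (isoRun τ a m).N = []) :
    (isoRun τ a m).V.length = a.length + evalCount τ (isoRun τ a m).H.length := by
  rw [isoRun_V_eq, List.length_append, List.length_map, length_isoLog, hN]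
  simp

/-- If `IsoType` returns the same partition on two tuples, then these have the same length, and
matching the lists returned gives a partial isomorphism that takes the one to the other. -/
theorem IsoTypeReturns.isPartialIso_mapOfLists [IsEmpty L.Constants] {τ : Vocabulary L}
    {a b : List A} {P : Finset (Finset ℕ)} {U U' : List A} (h : IsoTypeReturns τ a P U)
    (h' : IsoTypeReturns τ b P U') :
    IsPartialIso L (mapOfLists U U') ∧ (∀ x ∈ a, x ∈ U) ∧
      a.map (mapOfLists U U').toFun = b := by
  obtain ⟨m, h1, h2, hP, rfl⟩ := isoTypeReturns_iff.1 h
  obtain ⟨m', h1', h2', hP', rfl⟩ := isoTypeReturns_iff.1 h'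
  have hker : SameKer (isoRun τ a m).V (isoRun τ b m').V := by
    apply sameKer_of_indexPartition_eq
    rw [← (isoRun_consistent τ a m).1, ← (isoRun_consistent τ b m').1, ← hP, ← hP']
  have hHeq : (isoRun τ a m).H = (isoRun τ b m').H := by
    rw [(isoRun_consistent τ a m).2, (isoRun_consistent τ b m').2, hker.firstIndices_eq]
  -- The partition determines the number of values and the number of elements, and thereby the
  -- length of the input.
  have hab : a.length = b.length := by
    have e1 := length_isoRun_V h2
    have e2 := length_isoRun_V h2'
    rw [hker.1, hHeq] at e1
    omega
  obtain rfl : m = m' := by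
    rcases lt_trichotomy m m' with hlt | rfl | hlt
    · have h3 := (isoLog_congr hab List.prefix_rfl (isoRun_V_prefix τ b hlt.le) hker).2.2
      exact absurd (isoRun_N_congr h3 ▸ h2) (h1' m hlt)
    · rfl
    · have h3 := (isoLog_congr hab (isoRun_V_prefix τ a hlt.le) List.prefix_rfl hker).2.2
      exact absurd ((isoRun_N_congr h3).symm ▸ h2') (h1 m' hlt)
  have hlog := (isoLog_congr hab List.prefix_rfl List.prefix_rfl hker).1
  clear h1 h1' h h' hP hP'
  have hV := isoRun_V_eq τ a m
  have hW := isoRun_V_eq τ b m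
  have hH := (isoRun_consistent τ a m).2
  have hmem : ∀ i, (∀ k, i.2.2 k ∈ (isoRun τ a m).H) → i ∈ isoLog τ a m := fun i hi =>
    mem_isoLog τ a m i fun k => ⟨hi k, by simp [h2]⟩
  have hdom : ∀ x, x ∈ (isoRun τ a m).H.map (isoRun τ a m).val ↔ x ∈ (isoRun τ a m).V :=
    fun x => mem_map_val
  have hvalV : ∀ i ∈ (isoRun τ a m).H, (isoRun τ a m).V[i]? = some ((isoRun τ a m).val i) :=
    map_val_eq
  have hvalW : ∀ i ∈ (isoRun τ a m).H, (isoRun τ b m).V[i]? = some ((isoRun τ b m).val i) :=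
    hHeq ▸ map_val_eq
  have hnd := nodup_map_val τ a m
  rw [← hHeq]
  set V := (isoRun τ a m).V with hVdef
  set W := (isoRun τ b m).V with hWdef
  set H := (isoRun τ a m).H with hHdef
  set va := (isoRun τ a m).val with hva
  set vb := (isoRun τ b m).val with hvb
  set γ := mapOfLists (H.map va) (H.map vb) with hγ
  have hγH : ∀ i ∈ H, γ.toFun (va i) = vb i := by
    intro i hi
    obtain ⟨k, hk, rfl⟩ := List.mem_iff_getElem.1 hi
    have hk' : k < (H.map va).length := by simpa using hk
    have : (H.map va).idxOf (va H[k]) = k := by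
      have := hnd.idxOf_getElem k hk'
      simpa using this
    simp [hγ, mapOfLists, this, hk]
  -- The map takes each value of the first run to the value of the second run with the same index.
  have hγV : ∀ (p : ℕ) (x y : A), V[p]? = some x → W[p]? = some y → γ.toFun x = y := by
    intro p x y hx hy
    obtain ⟨j, hj, hjp⟩ := exists_mem_firstIndices (List.getElem?_eq_some_iff.1 hx).1
    rw [← hH] at hj
    have h3 := (hker.2 j p).1 hjp
    rw [hvalV j hj, hx, Option.some.injEq] at hjp
    rw [hvalW j hj, hy, Option.some.injEq] at h3
    rw [← hjp, ← h3, hγH j hj]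
  have hget : ∀ x ∈ V, ∃ (p : ℕ) (y : A), V[p]? = some x ∧ W[p]? = some y := by
    intro x hx
    obtain ⟨p, hp, rfl⟩ := List.mem_iff_getElem.1 hx
    exact ⟨p, W[p]'(hker.1 ▸ hp), List.getElem?_eq_getElem hp, List.getElem?_eq_getElem _⟩
  -- The values of an operation occur at the same index in both runs.
  have hop : ∀ (r : ℕ) (f : L.Functions r) (x : Fin r → A), (∀ i, x i ∈ γ.dom) →
      ∃ p : ℕ, V[p]? = some (Language.Structure.funMap f x) ∧
        W[p]? = some (Language.Structure.funMap f fun i => γ.toFun (x i)) := by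
    intro r f x hx
    choose l hl hlx using fun i => List.mem_map.1 (hx i)
    obtain rfl : (fun i => va (l i)) = x := funext hlx
    obtain ⟨q, hq⟩ := List.mem_iff_getElem?.1 (hmem ⟨r, f, l⟩ hl)
    refine ⟨a.length + q, ?_, ?_⟩
    · rw [hV, List.getElem?_append_right (Nat.le_add_right _ _), Nat.add_sub_cancel_left,
        List.getElem?_map, hq]
      rfl
    · rw [hW, hab, List.getElem?_append_right (Nat.le_add_right _ _), Nat.add_sub_cancel_left,
        List.getElem?_map, ← hlog, hq]
      simp only [hγH _ (hl _)]
      rfl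
  refine ⟨⟨?_, ?_, ?_⟩, ?_, ?_⟩
  · intro x hx y hy hxy
    obtain ⟨p, u, hp, hpu⟩ := hget x ((hdom x).1 hx)
    obtain ⟨q, v, hq, hqv⟩ := hget y ((hdom y).1 hy)
    rw [hγV p x u hp hpu, hγV q y v hq hqv] at hxy
    have := (hker.2 p q).2 (by rw [hpu, hqv, hxy])
    rw [hp, hq] at this
    exact Option.some.inj this
  · intro r f x hx
    obtain ⟨p, hp, -⟩ := hop r f x hx
    exact (hdom _).2 (List.mem_of_getElem? hp)
  · intro r f x hx
    obtain ⟨p, hp, hp'⟩ := hop r f x hx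
    exact hγV p _ _ hp hp'
  · intro x hx
    rw [hdom, hV]
    exact List.mem_append_left _ hx
  · refine List.ext_getElem (by simpa using hab) fun p hp hp' => ?_
    rw [List.length_map] at hp
    rw [List.getElem_map]
    refine hγV p _ _ ?_ ?_
    · rw [hV, List.getElem?_append_left hp, List.getElem?_eq_getElem hp]
    · rw [hW, List.getElem?_append_left hp', List.getElem?_eq_getElem hp']

theorem IsoTypeReturns.nodup {τ : Vocabulary L} {a : List A} {P : Finset (Finset ℕ)} {U : List A}
    (h : IsoTypeReturns τ a P U) : U.Nodup := by
  obtain ⟨m, -, -, -, rfl⟩ := isoTypeReturns_iff.1 h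
  exact nodup_map_val τ a m

theorem isoRun_V_subset {τ : Vocabulary L} {a : List A} {D : Set A} (ha : ∀ x ∈ a, x ∈ D)
    (hD : ∀ (r : ℕ) (f : L.Functions r), Language.ClosedUnder f D) (j : ℕ) :
    ∀ x ∈ (isoRun τ a j).V, x ∈ D := by
  induction j with
  | zero => exact ha
  | succ j ih =>
    intro x hx
    rw [isoRun_V_succ, List.mem_append] at hx
    rcases hx with hx | hx
    · exact ih x hx
    · obtain ⟨i, hi, rfl⟩ := List.mem_map.1 hx
      refine hD _ _ _ fun k => ih _ ?_
      have hk := lt_of_mem_instrs hi k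
      rw [List.getD_eq_getElem _ _ hk]
      exact List.getElem_mem hk

theorem IsoTypeReturns.mem_iff [IsEmpty L.Constants] {τ : Vocabulary L} {a : List A}
    {P : Finset (Finset ℕ)} {U : List A} (h : IsoTypeReturns τ a P U) {x : A} :
    x ∈ U ↔ x ∈ gen L a := by
  obtain ⟨h1, h2, -⟩ := h.isPartialIso_mapOfLists h
  refine ⟨fun hx => ?_, fun hx => gen_subset (D := {x | x ∈ U}) h2 h1.closed hx⟩
  obtain ⟨m, -, -, -, rfl⟩ := isoTypeReturns_iff.1 h
  exact isoRun_V_subset (fun x hx => mem_gen_of_mem hx) (gen_closed a) m x (mem_map_val.1 hx)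

/-- `IsoType` returns the same partition on isomorphic tuples. -/
theorem IsoTypeReturns.map {τ : Vocabulary L} {a : List A} {P : Finset (Finset ℕ)} {U : List A}
    (h : IsoTypeReturns τ a P U) {γ : PartialMap A} (hγ : IsPartialIso L γ)
    (ha : ∀ x ∈ a, x ∈ γ.dom) : IsoTypeReturns τ (a.map γ.toFun) P (U.map γ.toFun) := by
  have hdom := isoRun_V_subset (τ := τ) ha hγ.closed
  have hHV : ∀ j, (isoRun τ (a.map γ.toFun) j).V = (isoRun τ a j).V.map γ.toFun →
      (isoRun τ (a.map γ.toFun) j).H = (isoRun τ a j).H := fun j hj => by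
    rw [(isoRun_consistent τ a j).2, (isoRun_consistent τ _ j).2, hj,
      (sameKer_map hγ.injOn (hdom j)).firstIndices_eq]
  have key : ∀ j, (isoRun τ (a.map γ.toFun) j).V = (isoRun τ a j).V.map γ.toFun ∧
      (isoRun τ (a.map γ.toFun) j).N = (isoRun τ a j).N := by
    intro j
    induction j with
    | zero => exact ⟨rfl, hHV 0 rfl⟩
    | succ j ih =>
      have hV : (isoRun τ (a.map γ.toFun) (j + 1)).V =
          (isoRun τ a (j + 1)).V.map γ.toFun := by
        rw [isoRun_V_succ, isoRun_V_succ, ih.1, hHV j ih.1, ih.2, List.map_append, List.map_map]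
        congr 1
        refine List.map_congr_left fun i hi => ?_
        have hlt := lt_of_mem_instrs hi
        simp only [evalInstr, Function.comp_apply]
        rw [hγ.map_fun]
        · congr 1
          funext k
          simp [hlt k]
        · intro k
          simp only [hlt k, List.getD_eq_getElem]
          exact hdom j _ (List.getElem_mem _)
      exact ⟨hV, by rw [isoRun_N_succ, isoRun_N_succ, hHV _ hV, hHV _ ih.1]⟩
  obtain ⟨m, h1, h2, rfl, rfl⟩ := isoTypeReturns_iff.1 h
  refine isoTypeReturns_iff.2 ⟨m, fun j hj => (key j).2 ▸ h1 j hj, (key m).2.trans h2, ?_, ?_⟩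
  · rw [(isoRun_consistent τ a m).1, (isoRun_consistent τ _ m).1, (key m).1,
      (sameKer_map hγ.injOn (hdom m)).indexPartition_eq]
  · rw [hHV m (key m).1, List.map_map]
    refine List.map_congr_left fun i hi => ?_
    have := mem_isoRun_H_lt hi
    simp [IsoState.val, (key m).1, this]

end Result

/-! ### Quantifier-free definability -/

section Definability

variable {L : Language} {A : Type*} [L.Structure A]

theorem IsPartialIso.realize {γ : PartialMap A} (h : IsPartialIso L γ) {k : ℕ} {x : Fin k → A}
    (hx : ∀ i, x i ∈ γ.dom) (t : L.Term (Fin k)) :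
    t.realize x ∈ γ.dom ∧ t.realize (fun i => γ.toFun (x i)) = γ.toFun (t.realize x) := by
  induction t with
  | var i => exact ⟨hx i, rfl⟩
  | func f ts ih =>
    simp only [Language.Term.realize]
    exact ⟨h.closed _ f _ fun i => (ih i).1,
      by rw [h.map_fun _ f _ fun i => (ih i).1]; simp only [(ih _).2]⟩

theorem tupleIso_iff_isomorphic {k : ℕ} {x y : Fin k → A} :
    TupleIso L x y ↔ Isomorphic L (List.ofFn x) (List.ofFn y) := by
  classical
  constructor
  · intro h
    set g : A → A := fun z =>
      if hz : ∃ t : L.Term (Fin k), t.realize x = z then (Classical.choose hz).realize y else z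
      with hg
    have hgt : ∀ t : L.Term (Fin k), g (t.realize x) = t.realize y := by
      intro t
      have hz : ∃ t' : L.Term (Fin k), t'.realize x = t.realize x := ⟨t, rfl⟩
      simp only [hg, dif_pos hz]
      exact (h _ _).1 (Classical.choose_spec hz)
    refine ⟨⟨Set.range fun t : L.Term (Fin k) => t.realize x, g⟩, ⟨?_, ?_, ?_⟩, ?_, ?_⟩
    · rintro _ ⟨t, rfl⟩ _ ⟨s, rfl⟩ hts
      simp only [hgt] at hts
      exact (h t s).2 hts
    · intro r f z hz
      choose t ht using hz
      obtain rfl : (fun i => (t i).realize x) = z := funext ht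
      exact ⟨Language.Term.func f t, rfl⟩
    · intro r f z hz
      choose t ht using hz
      obtain rfl : (fun i => (t i).realize x) = z := funext ht
      simp only [hgt]
      exact hgt (Language.Term.func f t)
    · intro z hz
      obtain ⟨i, rfl⟩ := (List.mem_ofFn' _ _).1 hz
      exact ⟨Language.Term.var i, rfl⟩
    · rw [List.map_ofFn]
      congr 1
      funext i
      exact hgt (Language.Term.var i)
  · rintro ⟨γ, hγ, hx, hxy⟩ t s
    have hx' : ∀ i, x i ∈ γ.dom := fun i => hx _ ((List.mem_ofFn' _ _).2 ⟨i, rfl⟩)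
    rw [List.map_ofFn] at hxy
    obtain rfl : (fun i => γ.toFun (x i)) = y := List.ofFn_injective hxy
    rw [(hγ.realize hx' t).2, (hγ.realize hx' s).2]
    exact ⟨fun h => by rw [h], fun h => hγ.injOn (hγ.realize hx' t).1 (hγ.realize hx' s).1 h⟩

variable {n : ℕ}

theorem realize_iff_of_tupleIso [L.IsAlgebraic] {φ : L.Formula (Fin n)}
    (hφ : Language.BoundedFormula.IsQF φ) {a b : Fin n → A} (h : TupleIso L a b) :
    φ.Realize a ↔ φ.Realize b := by
  have hterm : ∀ (t : L.Term (Fin n ⊕ Fin 0)) (v : Fin n → A) (xs : Fin 0 → A),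
      t.realize (Sum.elim v xs) = (t.relabel (Sum.elim id Fin.elim0)).realize v := by
    intro t v xs
    rw [Language.Term.realize_relabel]
    congr 1
    funext i
    rcases i with i | i
    · rfl
    · exact i.elim0
  simp only [Language.Formula.Realize]
  generalize (default : Fin 0 → A) = xs
  induction hφ with
  | falsum => exact Iff.rfl
  | of_isAtomic hat =>
    cases hat with
    | equal t s =>
      rw [Language.BoundedFormula.realize_bdEqual, Language.BoundedFormula.realize_bdEqual,
        hterm, hterm, hterm, hterm]
      exact h _ _
    | rel R => exact isEmptyElim R
  | imp _ _ ih₁ ih₂ =>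
    rw [Language.BoundedFormula.realize_imp, Language.BoundedFormula.realize_imp]
    exact imp_congr ih₁ ih₂

theorem QfDefinable.compl {R : Set (Fin n → A)} (h : QfDefinable L R) : QfDefinable L Rᶜ := by
  obtain ⟨φ, hφ, rfl⟩ := h
  exact ⟨φ.not, hφ.not, by ext a; simp⟩

theorem QfDefinable.union {R S : Set (Fin n → A)} (h : QfDefinable L R) (h' : QfDefinable L S) :
    QfDefinable L (R ∪ S) := by
  obtain ⟨φ, hφ, rfl⟩ := h
  obtain ⟨ψ, hψ, rfl⟩ := h'
  exact ⟨φ ⊔ ψ, hφ.sup hψ, by ext a; simp⟩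

theorem qfDefinable_empty : QfDefinable L (∅ : Set (Fin n → A)) :=
  ⟨⊥, Language.BoundedFormula.isQF_bot, by ext a; simp⟩

theorem QfDefinable.biUnion {ι : Type*} {s : Set ι} (hs : s.Finite) {R : ι → Set (Fin n → A)}
    (h : ∀ i ∈ s, QfDefinable L (R i)) : QfDefinable L (⋃ i ∈ s, R i) := by
  induction s, hs using Set.Finite.induction_on with
  | empty => simpa using qfDefinable_empty
  | insert _ _ ih =>
    rw [Set.biUnion_insert]
    exact (h _ (Set.mem_insert _ _)).union (ih fun i hi => h i (Set.mem_insert_of_mem _ hi))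

theorem QfDefinable.biInter {ι : Type*} {s : Set ι} (hs : s.Finite) {R : ι → Set (Fin n → A)}
    (h : ∀ i ∈ s, QfDefinable L (R i)) : QfDefinable L (⋂ i ∈ s, R i) := by
  rw [← compl_compl (⋂ i ∈ s, R i)]
  simp only [Set.compl_iInter]
  exact (QfDefinable.biUnion hs fun i hi => (h i hi).compl).compl

theorem qfDefinable_termEq (t s : L.Term (Fin n)) :
    QfDefinable L {a : Fin n → A | t.realize a = s.realize a} :=
  ⟨t.equal s, (Language.BoundedFormula.IsAtomic.equal _ _).isQF, by
    ext a; simp [Language.Formula.realize_equal]⟩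

/-- A relation on a finite algebra is quantifier-free definable if and only if it is closed under
isomorphism of tuples. For the converse, the type of a tuple is the intersection of finitely many
definable sets, each of which separates it from one of the tuples not isomorphic to it. -/
theorem qfDefinable_iff [L.IsAlgebraic] [Finite A] {R : Set (Fin n → A)} :
    QfDefinable L R ↔ ∀ a ∈ R, ∀ b, TupleIso L a b → b ∈ R := by
  constructor
  · rintro ⟨φ, hφ, rfl⟩ a ha b hab
    exact (realize_iff_of_tupleIso hφ hab).1 ha
  · intro h
    have hsep : ∀ a b : Fin n → A, ∃ S : Set (Fin n → A), QfDefinable L S ∧ a ∈ S ∧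
        (b ∈ S → TupleIso L a b) := by
      intro a b
      by_cases hab : TupleIso L a b
      · exact ⟨∅ᶜ, qfDefinable_empty.compl, by simp, fun _ => hab⟩
      · simp only [TupleIso, not_forall] at hab
        obtain ⟨t, s, hts⟩ := hab
        by_cases hta : t.realize a = s.realize a
        · exact ⟨_, qfDefinable_termEq t s, hta, fun hb => absurd (iff_of_true hta hb) hts⟩
        · exact ⟨_, (qfDefinable_termEq t s).compl, hta,
            fun hb => absurd (iff_of_false hta hb) hts⟩
    choose S hS haS hST using hsep
    have hR : R = ⋃ a ∈ R, ⋂ b ∈ (Set.univ : Set (Fin n → A)), S a b := by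
      apply Set.Subset.antisymm
      · intro a ha
        exact Set.mem_biUnion ha (Set.mem_iInter₂.2 fun b _ => haS a b)
      · intro b hb
        obtain ⟨a, ha, hb⟩ := Set.mem_iUnion₂.1 hb
        exact h a ha b (hST a b (Set.mem_iInter₂.1 hb b trivial))
    rw [hR]
    exact QfDefinable.biUnion (Set.toFinite _) fun a _ =>
      QfDefinable.biInter (Set.toFinite _) fun b _ => hS a b

end Definability

section RelType

variable {A : Type*} {n : ℕ}

theorem pattern_comp {c : Fin n → A} {g : A → A} {D : Set A} (hg : Set.InjOn g D)
    (hc : ∀ i, c i ∈ D) : pattern (fun i => g (c i)) = pattern c :=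
  Setoid.ext fun i j => hg.eq_iff (hc i) (hc j)

variable [DecidableEq A]

theorem mem_floorTuple {l : List A} {x : A} : x ∈ floorTuple l ↔ x ∈ l := by
  induction l with
  | nil => rfl
  | cons y l ih =>
    by_cases h : x = y <;> simp [floorTuple, ih, h]

theorem nodup_floorTuple (l : List A) : (floorTuple l).Nodup := by
  induction l with
  | nil => exact List.nodup_nil
  | cons y l ih => exact List.nodup_cons.2 ⟨by simp, ih.filter _⟩

theorem floorTuple_map {l : List A} {g : A → A} {D : Set A} (hg : Set.InjOn g D)
    (hl : ∀ x ∈ l, x ∈ D) : floorTuple (l.map g) = (floorTuple l).map g := by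
  induction l with
  | nil => rfl
  | cons y l ih =>
    rw [List.map_cons, floorTuple, floorTuple, List.map_cons,
      ih fun x hx => hl x (List.mem_cons_of_mem _ hx), List.filter_map]
    congr 2
    refine List.filter_congr fun x hx => ?_
    have hxl := hl x (List.mem_cons_of_mem _ (mem_floorTuple.1 hx))
    have := hg.eq_iff hxl (hl y List.mem_cons_self)
    simp [this]

/-- A tuple is determined by its pattern and by the list of its distinct entries. -/
theorem eq_of_floorTuple_eq {c d : Fin n → A} (hp : pattern c = pattern d)
    (hf : floorTuple (List.ofFn c) = floorTuple (List.ofFn d)) : c = d := by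
  classical
  have hcd : ∀ i j, c i = c j ↔ d i = d j := fun i j => by
    have : (pattern c) i j ↔ (pattern d) i j := by rw [hp]
    exact this
  set g : A → A := fun z => if hz : ∃ i, c i = z then d (Classical.choose hz) else z with hg
  have hgc : ∀ i, g (c i) = d i := by
    intro i
    have hz : ∃ j, c j = c i := ⟨i, rfl⟩
    simp only [hg, dif_pos hz]
    exact (hcd _ _).1 (Classical.choose_spec hz)
  have hmap : List.ofFn d = (List.ofFn c).map g := by
    rw [List.map_ofFn]
    congr 1
    funext i
    exact (hgc i).symm
  have hinj : Set.InjOn g (Set.range c) := by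
    rintro _ ⟨i, rfl⟩ _ ⟨j, rfl⟩ hij
    rw [hgc, hgc] at hij
    exact (hcd i j).2 hij
  have hmem : ∀ x ∈ List.ofFn c, x ∈ Set.range c := fun x hx => (List.mem_ofFn' _ _).1 hx
  rw [hmap, floorTuple_map hinj hmem] at hf
  funext i
  have hfix := List.map_inj_left.1 (hf.symm.trans (List.map_id _).symm) (c i)
    (mem_floorTuple.2 ((List.mem_ofFn' _ _).2 ⟨i, rfl⟩))
  rw [← hgc i, hfix, id]

variable {L : Language} [L.Structure A]

/-- A relation is quantifier-free definable if and only if isomorphic tuples without repeated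
entries have the same relType. -/
theorem qfDefinable_iff_relType [Nonempty A] [L.IsAlgebraic] [Finite A] {R : Set (Fin n → A)} :
    QfDefinable L R ↔ ∀ a b : List A, a.length ∈ spec R → a.Nodup → Isomorphic L a b →
      relType R a = relType R b := by
  rw [qfDefinable_iff]
  constructor
  · intro h a b _ _ hab
    have key : ∀ (a b : List A) (T : targets R), Isomorphic L a b → a ∈ T.1 → b ∈ T.1 := by
      rintro a _ ⟨_, c₀, -, rfl⟩ ⟨γ, hγ, ha, rfl⟩ ⟨c, ⟨hcR, hcp⟩, rfl⟩
      have hc : ∀ x ∈ List.ofFn c, x ∈ γ.dom := fun x hx => ha x (mem_floorTuple.2 hx)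
      have hc' : ∀ i, c i ∈ γ.dom := fun i => hc _ ((List.mem_ofFn' _ _).2 ⟨i, rfl⟩)
      have hmap : List.ofFn (fun i => γ.toFun (c i)) = (List.ofFn c).map γ.toFun := by
        rw [List.map_ofFn]; rfl
      refine ⟨fun i => γ.toFun (c i), ⟨h c hcR _ ?_, ?_⟩, ?_⟩
      · exact tupleIso_iff_isomorphic.2 ⟨γ, hγ, hc, hmap.symm⟩
      · rw [pattern_comp hγ.injOn hc', hcp]
      · rw [hmap, floorTuple_map hγ.injOn hc]
    funext T
    exact propext ⟨key a b T hab, key b a T hab.symm⟩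
  · intro h c hc d hcd
    obtain ⟨γ, hγ, hcγ, hd⟩ := tupleIso_iff_isomorphic.1 hcd
    have hdc : d = fun i => γ.toFun (c i) := by
      rw [List.map_ofFn] at hd
      exact (List.ofFn_injective hd).symm
    have hpat : pattern d = pattern c := by
      rw [hdc]
      exact pattern_comp hγ.injOn fun i => hcγ _ ((List.mem_ofFn' _ _).2 ⟨i, rfl⟩)
    have hrel := h (floorTuple (List.ofFn c)) (floorTuple (List.ofFn d)) ⟨c, hc, rfl⟩
      (nodup_floorTuple _) ⟨γ, hγ, fun x hx => hcγ x (mem_floorTuple.1 hx), by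
        rw [← hd, floorTuple_map hγ.injOn hcγ]⟩
    obtain ⟨d', ⟨hd'R, hd'p⟩, hd'⟩ := (congrFun hrel ⟨_, c, hc, rfl⟩).mp ⟨c, ⟨hc, rfl⟩, rfl⟩
    rw [eq_of_floorTuple_eq (hpat.trans hd'p.symm) hd']
    exact hd'R

end RelType

/-! ### Operations on the annotated blocks -/

section OrbitData

variable {A : Type*} [DecidableEq A] {n : ℕ} {R : Set (Fin n → A)} {o : Orbits R}

/-- The tuples without repeated entries over `S` whose length is in the spectrum. -/
def IsTuple (R : Set (Fin n → A)) (S : Set A) (a : List A) : Prop :=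
  a.length ∈ spec R ∧ a.Nodup ∧ ∀ x ∈ a, x ∈ S

/-- The tuples `a` and `b` are in the same block. -/
def Orbits.Sim (o : Orbits R) (a b : List A) : Prop :=
  ∃ O, o.IsOrbitOf a O ∧ o.IsOrbitOf b O

/-- The type of the orbit of `a` is known. -/
def Orbits.Tagged (o : Orbits R) (a : List A) : Prop :=
  ∃ O, o.IsOrbitOf a O ∧ O.T ≠ none

theorem Orbits.Sim.symm {a b : List A} (h : o.Sim a b) : o.Sim b a :=
  let ⟨O, h1, h2⟩ := h
  ⟨O, h2, h1⟩

theorem Orbit.merge_T_ne_none {O O' : Orbit R} :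
    (O.merge O').T ≠ none ↔ O.T ≠ none ∨ O'.T ≠ none := by
  simp only [Orbit.merge]
  cases O.T <;> cases O'.T <;> simp

variable {L : Language} [L.Structure A] [Nonempty A] {τ : Vocabulary L}

/-- The blocks partition the set of tuples, and the annotations are correct: the tags of an orbit
are those that `IsoType` returns on some tuple in it. -/
structure Orbits.Good (τ : Vocabulary L) (o : Orbits R) : Prop where
  tuple : ∀ k, ∀ O ∈ o k, ∀ c ∈ O.B, c.length = k ∧ IsTuple R Set.univ c
  nonempty : ∀ k, ∀ O ∈ o k, O.B.Nonempty
  exists_orbit : ∀ a, IsTuple R Set.univ a → ∃ O, o.IsOrbitOf a O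
  unique : ∀ a O O', o.IsOrbitOf a O → o.IsOrbitOf a O' → O = O'
  relType_eq : ∀ a O, o.IsOrbitOf a O → relType R a = O.RT
  tag : ∀ k, ∀ O ∈ o k, ∀ P, O.T = some P →
    ∃ U, O.U = some U ∧ ∃ c ∈ O.B, IsoTypeReturns τ c P U

namespace Orbits.Good

theorem sim_refl (ho : o.Good τ) {a : List A} (ha : IsTuple R Set.univ a) : o.Sim a a :=
  let ⟨O, h⟩ := ho.exists_orbit a ha
  ⟨O, h, h⟩

theorem sim_trans (ho : o.Good τ) {a b c : List A} (h : o.Sim a b) (h' : o.Sim b c) :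
    o.Sim a c := by
  obtain ⟨O, h1, h2⟩ := h
  obtain ⟨O', h1', h2'⟩ := h'
  obtain rfl := ho.unique _ _ _ h2 h1'
  exact ⟨O, h1, h2'⟩

theorem tuple_of_tagged (ho : o.Good τ) {a : List A} (h : o.Tagged a) : IsTuple R Set.univ a :=
  let ⟨O, h1, _⟩ := h
  (ho.tuple _ O h1.1 a h1.2).2

theorem isOrbitOf_of_mem (ho : o.Good τ) {k : ℕ} {O : Orbit R} (hO : O ∈ o k) {a : List A}
    (ha : a ∈ O.B) : o.IsOrbitOf a O := by
  obtain ⟨rfl, -⟩ := ho.tuple k O hO a ha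
  exact ⟨hO, ha⟩

theorem tagged_of_sim (ho : o.Good τ) {a b : List A} (h : o.Sim a b) (hb : o.Tagged b) :
    o.Tagged a := by
  obtain ⟨O, h1, h2⟩ := h
  obtain ⟨O', h1', h2'⟩ := hb
  obtain rfl := ho.unique _ _ _ h2 h1'
  exact ⟨O, h1, h2'⟩

section Replace

variable {k : ℕ} {old : Set (Orbit R)} {new : Orbit R}

theorem isOrbitOf_replace (ho : o.Good τ) (hold : old ⊆ o k)
    (hB : ∀ a, a ∈ new.B ↔ ∃ O ∈ old, a ∈ O.B) {a : List A} {O : Orbit R} :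
    (o.replace k old new).IsOrbitOf a O ↔
      (O = new ∧ a ∈ new.B) ∨ (o.IsOrbitOf a O ∧ a ∉ new.B) := by
  have hlen : ∀ a ∈ new.B, a.length = k := fun a ha =>
    let ⟨O, hO, haO⟩ := (hB a).1 ha
    (ho.tuple k O (hold hO) a haO).1
  have hnot : o.IsOrbitOf a O → (a ∉ new.B ↔ O ∉ old) := fun h => by
    rw [hB]
    constructor
    · exact fun hne hO => hne ⟨O, hO, h.2⟩
    · rintro hO ⟨O', hO', haO'⟩
      rw [ho.unique _ _ _ h (ho.isOrbitOf_of_mem (hold hO') haO')] at hO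
      exact hO hO'
  by_cases hk : a.length = k
  · subst hk
    simp only [Orbits.IsOrbitOf, Orbits.replace, Function.update_self, Set.mem_insert_iff,
      Set.mem_sdiff]
    constructor
    · rintro ⟨rfl | ⟨h1, h2⟩, h3⟩
      · exact Or.inl ⟨rfl, h3⟩
      · exact Or.inr ⟨⟨h1, h3⟩, (hnot ⟨h1, h3⟩).2 h2⟩
    · rintro (⟨rfl, h⟩ | ⟨⟨h1, h3⟩, h2⟩)
      · exact ⟨Or.inl rfl, h⟩
      · exact ⟨Or.inr ⟨h1, (hnot ⟨h1, h3⟩).1 h2⟩, h3⟩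
  · simp only [Orbits.IsOrbitOf, Orbits.replace, Function.update_of_ne hk]
    have : a ∉ new.B := fun h => hk (hlen a h)
    simp [this]

theorem sim_replace (ho : o.Good τ) (hold : old ⊆ o k)
    (hB : ∀ a, a ∈ new.B ↔ ∃ O ∈ old, a ∈ O.B) {a b : List A} :
    (o.replace k old new).Sim a b ↔ o.Sim a b ∨ (a ∈ new.B ∧ b ∈ new.B) := by
  simp only [Orbits.Sim, ho.isOrbitOf_replace hold hB]
  constructor
  · rintro ⟨O, ⟨rfl, h1⟩ | ⟨h1, h1'⟩, ⟨h, h2⟩ | ⟨h2, h2'⟩⟩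
    · exact Or.inr ⟨h1, h2⟩
    · exact Or.inr ⟨h1, absurd h2.2 h2'⟩
    · subst h
      exact absurd h1.2 h1'
    · exact Or.inl ⟨O, h1, h2⟩
  · rintro (⟨O, h1, h2⟩ | ⟨h1, h2⟩)
    · by_cases hO : O ∈ old
      · exact ⟨new, Or.inl ⟨rfl, (hB a).2 ⟨O, hO, h1.2⟩⟩, Or.inl ⟨rfl, (hB b).2 ⟨O, hO, h2.2⟩⟩⟩
      · have : ∀ c, o.IsOrbitOf c O → c ∉ new.B := by
          intro c hc hc'
          obtain ⟨O', hO', hcO'⟩ := (hB c).1 hc'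
          rw [ho.unique _ _ _ hc (ho.isOrbitOf_of_mem (hold hO') hcO')] at hO
          exact hO hO'
        exact ⟨O, Or.inr ⟨h1, this _ h1⟩, Or.inr ⟨h2, this _ h2⟩⟩
    · exact ⟨new, Or.inl ⟨rfl, h1⟩, Or.inl ⟨rfl, h2⟩⟩

theorem tagged_replace (ho : o.Good τ) (hold : old ⊆ o k)
    (hB : ∀ a, a ∈ new.B ↔ ∃ O ∈ old, a ∈ O.B) {a : List A} :
    (o.replace k old new).Tagged a ↔
      (a ∈ new.B ∧ new.T ≠ none) ∨ (a ∉ new.B ∧ o.Tagged a) := by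
  simp only [Orbits.Tagged, ho.isOrbitOf_replace hold hB]
  constructor
  · rintro ⟨O, ⟨rfl, h1⟩ | ⟨h1, h1'⟩, h2⟩
    · exact Or.inl ⟨h1, h2⟩
    · exact Or.inr ⟨h1', O, h1, h2⟩
  · rintro (⟨h1, h2⟩ | ⟨h1, O, h2, h3⟩)
    · exact ⟨new, Or.inl ⟨rfl, h1⟩, h2⟩
    · exact ⟨O, Or.inr ⟨h2, h1⟩, h3⟩

theorem replace (ho : o.Good τ) (hold : old ⊆ o k) (hne : old.Nonempty)
    (hB : ∀ a, a ∈ new.B ↔ ∃ O ∈ old, a ∈ O.B) (hRT : ∀ O ∈ old, O.RT = new.RT)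
    (htag : ∀ P, new.T = some P → ∃ U, new.U = some U ∧ ∃ c ∈ new.B, IsoTypeReturns τ c P U) :
    (o.replace k old new).Good τ := by
  have hmem : ∀ k' O, O ∈ o.replace k old new k' → O ∈ o k' ∨ (O = new ∧ k' = k) := by
    intro k' O hO
    rcases eq_or_ne k' k with rfl | hk
    · rw [Orbits.replace, Function.update_self] at hO
      rcases hO with rfl | hO
      · exact Or.inr ⟨rfl, rfl⟩
      · exact Or.inl hO.1
    · rw [Orbits.replace, Function.update_of_ne hk] at hO
      exact Or.inl hO
  have hiff := @isOrbitOf_replace _ _ _ _ _ _ _ _ _ _ _ _ ho hold hB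
  refine ⟨?_, ?_, ?_, ?_, ?_, ?_⟩
  · rintro k' O hO c hc
    rcases hmem k' O hO with hO | ⟨rfl, rfl⟩
    · exact ho.tuple k' O hO c hc
    · obtain ⟨O', hO', hc'⟩ := (hB c).1 hc
      exact ho.tuple _ O' (hold hO') c hc'
  · intro k' O hO
    rcases hmem k' O hO with hO | ⟨rfl, rfl⟩
    · exact ho.nonempty k' O hO
    · obtain ⟨O', hO'⟩ := hne
      obtain ⟨c, hc⟩ := ho.nonempty _ O' (hold hO')
      exact ⟨c, (hB c).2 ⟨O', hO', hc⟩⟩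
  · intro a ha
    by_cases han : a ∈ new.B
    · exact ⟨new, hiff.2 (Or.inl ⟨rfl, han⟩)⟩
    · obtain ⟨O, hO⟩ := ho.exists_orbit a ha
      exact ⟨O, hiff.2 (Or.inr ⟨hO, han⟩)⟩
  · intro a O O' h h'
    rcases hiff.1 h with ⟨rfl, h1⟩ | ⟨h1, h2⟩ <;> rcases hiff.1 h' with ⟨rfl, h1'⟩ | ⟨h1', h2'⟩
    · rfl
    · exact absurd h1 h2'
    · exact absurd h1' h2
    · exact ho.unique _ _ _ h1 h1'
  · intro a O h
    rcases hiff.1 h with ⟨rfl, h1⟩ | ⟨h1, -⟩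
    · obtain ⟨O', hO', ha⟩ := (hB a).1 h1
      rw [← hRT O' hO']
      exact ho.relType_eq a O' (ho.isOrbitOf_of_mem (hold hO') ha)
    · exact ho.relType_eq a O h1
  · intro k' O hO
    rcases hmem k' O hO with hO | ⟨rfl, rfl⟩
    · exact ho.tag k' O hO
    · exact htag

end Replace

end Orbits.Good

/-- The effect of tagging the orbit of `a`. -/
theorem Orbits.Good.tagOrbit (ho : o.Good τ) {a : List A} {O : Orbit R} (hO : o.IsOrbitOf a O)
    {P : Finset (Finset ℕ)} {U : List A} (h : IsoTypeReturns τ a P U) :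
    (o.replace a.length {O} (O.tag P U)).Good τ ∧
      (∀ b c, (o.replace a.length {O} (O.tag P U)).Sim b c ↔ o.Sim b c) ∧
      ∀ b, (o.replace a.length {O} (O.tag P U)).Tagged b ↔ o.Tagged b ∨ o.Sim b a := by
  have hold : {O} ⊆ o a.length := Set.singleton_subset_iff.2 hO.1
  have hB : ∀ b, b ∈ (O.tag P U).B ↔ ∃ Q ∈ ({O} : Set (Orbit R)), b ∈ Q.B := by
    intro b
    simp [Orbit.tag]
  have hsim : ∀ b, o.Sim b a ↔ b ∈ O.B := by
    intro b
    constructor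
    · rintro ⟨Q, h1, h2⟩
      rw [ho.unique _ _ _ hO h2]
      exact h1.2
    · exact fun hb => ⟨O, ho.isOrbitOf_of_mem hO.1 hb, hO⟩
  refine ⟨ho.replace hold ⟨O, rfl⟩ hB ?_ ?_, fun b c => ?_, fun b => ?_⟩
  · rintro _ rfl
    rfl
  · rintro P' hP'
    obtain rfl : P = P' := Option.some.inj hP'
    exact ⟨U, rfl, a, hO.2, h⟩
  · rw [ho.sim_replace hold hB, or_iff_left_of_imp]
    rintro ⟨hb, hc⟩
    exact ho.sim_trans ((hsim b).2 hb) ((hsim c).2 hc).symm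
  · rw [ho.tagged_replace hold hB, hsim]
    simp only [Orbit.tag, ne_eq, reduceCtorEq, not_false_eq_true, and_true]
    tauto

/-- The effect of merging the orbits of `a` and `b`. -/
theorem Orbits.Good.mergeOrbits (ho : o.Good τ) {a b : List A} {O O' : Orbit R}
    (hO : o.IsOrbitOf a O) (hO' : o.IsOrbitOf b O') (hlen : b.length = a.length)
    (hRT : O.RT = O'.RT) :
    (o.replace a.length {O, O'} (O.merge O')).Good τ ∧
      (∀ c d, (o.replace a.length {O, O'} (O.merge O')).Sim c d ↔
        o.Sim c d ∨ ((o.Sim c a ∨ o.Sim c b) ∧ (o.Sim d a ∨ o.Sim d b))) ∧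
      ∀ c, (o.replace a.length {O, O'} (O.merge O')).Tagged c ↔
        o.Tagged c ∨ ((o.Sim c a ∨ o.Sim c b) ∧ (o.Tagged a ∨ o.Tagged b)) := by
  have hold : {O, O'} ⊆ o a.length := by
    rintro _ (rfl | rfl)
    · exact hO.1
    · exact hlen ▸ hO'.1
  have hB : ∀ b, b ∈ (O.merge O').B ↔ ∃ Q ∈ ({O, O'} : Set (Orbit R)), b ∈ Q.B := by
    intro b
    simp [Orbit.merge]
  have hsim : ∀ {a : List A} {O : Orbit R}, o.IsOrbitOf a O → ∀ b, o.Sim b a ↔ b ∈ O.B := by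
    intro a O hO b
    constructor
    · rintro ⟨Q, h1, h2⟩
      rw [ho.unique _ _ _ hO h2]
      exact h1.2
    · exact fun hb => ⟨O, ho.isOrbitOf_of_mem hO.1 hb, hO⟩
  have hBs : ∀ c, c ∈ (O.merge O').B ↔ o.Sim c a ∨ o.Sim c b := by
    intro c
    rw [hsim hO, hsim hO']
    rfl
  have htag : ∀ {a : List A} {O : Orbit R}, o.IsOrbitOf a O → (o.Tagged a ↔ O.T ≠ none) := by
    intro a O hO
    constructor
    · rintro ⟨Q, h1, h2⟩
      rwa [ho.unique _ _ _ hO h1]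
    · exact fun h => ⟨O, hO, h⟩
  refine ⟨ho.replace hold ⟨O, Or.inl rfl⟩ hB ?_ ?_, fun c d => ?_, fun c => ?_⟩
  · rintro _ (rfl | rfl)
    · rfl
    · exact hRT.symm
  · intro P hP
    by_cases hT : O.T.isSome
    · simp only [Orbit.merge, hT, if_true] at hP ⊢
      obtain ⟨U, hU, c, hc, h⟩ := ho.tag _ O hO.1 P hP
      exact ⟨U, hU, c, Or.inl hc, h⟩
    · by_cases hT' : O'.T.isSome
      · simp only [Orbit.merge, hT, hT', if_true] at hP ⊢
        obtain ⟨U, hU, c, hc, h⟩ := ho.tag _ O' hO'.1 P hP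
        exact ⟨U, hU, c, Or.inr hc, h⟩
      · simp [Orbit.merge, hT, hT'] at hP
  · rw [ho.sim_replace hold hB, hBs, hBs]
  · rw [ho.tagged_replace hold hB, hBs, Orbit.merge_T_ne_none, htag hO, htag hO']
    constructor
    · rintro (h | h)
      · exact Or.inr h
      · exact Or.inl h.2
    · rintro (h | h)
      · by_cases hc : o.Sim c a ∨ o.Sim c b
        · refine Or.inl ⟨hc, ?_⟩
          rw [← htag hO, ← htag hO']
          exact hc.imp (fun hc => ho.tagged_of_sim hc.symm h) (fun hc => ho.tagged_of_sim hc.symm h)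
        · exact Or.inr ⟨hc, h⟩
      · exact Or.inl h

/-- The effect of a call of the merging procedure: the new equivalence relation is generated by the
old one and the pairs `(c, γ c)`, and an orbit is tagged if it contains a formerly tagged one. -/
structure MergeSpec (τ : Vocabulary L) (γ : PartialMap A) (l : List (List A)) (o : Orbits R)
    (b : Bool) (o' : Orbits R) : Prop where
  good : o'.Good τ
  sim_mono : ∀ c d, o.Sim c d → o'.Sim c d
  tagged_mono : ∀ c, o.Tagged c → o'.Tagged c
  sim_le : ∀ Q : List A → List A → Prop, (∀ c d, o.Sim c d → Q c d) →
    (∀ c ∈ l, Q c (c.map γ.toFun)) → (∀ c d, Q c d → Q d c) →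
    (∀ c d e, Q c d → Q d e → Q c e) → ∀ c d, o'.Sim c d → Q c d
  exists_tagged : ∀ c, o'.Tagged c → ∃ d, o'.Sim c d ∧ o.Tagged d
  of_true : b = true → ∀ c ∈ l, o'.Sim c (c.map γ.toFun)
  of_false : b = false → ∃ c ∈ l, relType R c ≠ relType R (c.map γ.toFun)

theorem TryMerge.mergeSpec {γ : PartialMap A} {l : List (List A)} {b : Bool} {o' : Orbits R}
    (h : TryMerge γ l o b o') (ho : o.Good τ) : MergeSpec τ γ l o b o' := by
  induction h with
  | done o =>
    exact ⟨ho, fun _ _ => id, fun _ => id, fun Q h _ _ _ => h,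
      fun c hc => ⟨c, ho.sim_refl (ho.tuple_of_tagged hc), hc⟩, by simp, by simp⟩
  | same O h1 h2 _ ih =>
    have ih := ih ho
    refine { ih with
      sim_le := fun Q h3 h4 => ih.sim_le Q h3 fun c hc => h4 c (List.mem_cons_of_mem _ hc)
      of_true := fun hb c hc => ?_
      of_false := fun hb => ?_ }
    · rcases List.mem_cons.1 hc with rfl | hc
      · exact ih.sim_mono _ _ ⟨O, h1, h2⟩
      · exact ih.of_true hb c hc
    · obtain ⟨c, hc, hne⟩ := ih.of_false hb
      exact ⟨c, List.mem_cons_of_mem _ hc, hne⟩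
  | @differ a l o O O' h1 h2 _ hRT =>
    refine ⟨ho, fun _ _ => id, fun _ => id, fun Q h _ _ _ => h,
      fun c hc => ⟨c, ho.sim_refl (ho.tuple_of_tagged hc), hc⟩, by simp, fun _ => ?_⟩
    refine ⟨a, List.mem_cons_self, ?_⟩
    rwa [ho.relType_eq _ _ h1, ho.relType_eq _ _ h2]
  | @merge a l o b o' O O' h1 h2 _ hRT _ ih =>
    obtain ⟨g1, g2, g3⟩ := ho.mergeOrbits h1 h2 (by simp) hRT
    have ih := ih g1
    have ha := ho.sim_refl (ho.tuple _ _ h1.1 _ h1.2).2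
    have hb := ho.sim_refl (ho.tuple _ _ h2.1 _ h2.2).2
    refine ⟨ih.good, fun c d h => ih.sim_mono c d ((g2 c d).2 (Or.inl h)),
      fun c h => ih.tagged_mono c ((g3 c).2 (Or.inl h)), fun Q q1 q2 q3 q4 => ?_, ?_, ?_, ?_⟩
    · refine ih.sim_le Q (fun c d hcd => ?_) (fun c hc => q2 c (List.mem_cons_of_mem _ hc)) q3 q4
      have hQ := q2 a List.mem_cons_self
      rcases (g2 c d).1 hcd with h | ⟨hc, hd⟩
      · exact q1 c d h
      · have hca : Q c a := hc.elim (q1 _ _) fun h => q4 _ _ _ (q1 _ _ h) (q3 _ _ hQ)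
        have hda : Q d a := hd.elim (q1 _ _) fun h => q4 _ _ _ (q1 _ _ h) (q3 _ _ hQ)
        exact q4 _ _ _ hca (q3 _ _ hda)
    · intro c hc
      obtain ⟨d, hcd, hd⟩ := ih.exists_tagged c hc
      rcases (g3 d).1 hd with h | ⟨h, h'⟩
      · exact ⟨d, hcd, h⟩
      · rcases h' with h' | h'
        · exact ⟨a, ih.good.sim_trans hcd (ih.sim_mono _ _ ((g2 _ _).2 (Or.inr ⟨h, Or.inl ha⟩))),
            h'⟩
        · exact ⟨_, ih.good.sim_trans hcd (ih.sim_mono _ _ ((g2 _ _).2 (Or.inr ⟨h, Or.inr hb⟩))),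
            h'⟩
    · intro hb' c hc
      rcases List.mem_cons.1 hc with rfl | hc
      · exact ih.sim_mono _ _ ((g2 _ _).2 (Or.inr ⟨Or.inl ha, Or.inr hb⟩))
      · exact ih.of_true hb' c hc
    · intro hb'
      obtain ⟨c, hc, hne⟩ := ih.of_false hb'
      exact ⟨c, List.mem_cons_of_mem _ hc, hne⟩

/-- The merging procedure does not get stuck. -/
theorem Orbits.Good.exists_tryMerge (ho : o.Good τ) {γ : PartialMap A} {l : List (List A)}
    (hl : ∀ c ∈ l, IsTuple R Set.univ c ∧ IsTuple R Set.univ (c.map γ.toFun)) :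
    ∃ b o', TryMerge γ l o b o' := by
  induction l generalizing o with
  | nil => exact ⟨_, _, TryMerge.done o⟩
  | cons a l ih =>
    obtain ⟨O, hO⟩ := ho.exists_orbit _ (hl a List.mem_cons_self).1
    obtain ⟨O', hO'⟩ := ho.exists_orbit _ (hl a List.mem_cons_self).2
    have hl' := fun c hc => hl c (List.mem_cons_of_mem a hc)
    by_cases hne : O = O'
    · subst hne
      obtain ⟨b, o', h⟩ := ih ho hl'
      exact ⟨b, o', TryMerge.same O hO hO' h⟩
    · by_cases hRT : O.RT = O'.RT
      · obtain ⟨b, o', h⟩ := ih (ho.mergeOrbits hO hO' (by simp) hRT).1 hl'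
        exact ⟨b, o', TryMerge.merge O O' hO hO' hne hRT h⟩
      · exact ⟨false, o, TryMerge.differ O O' hO hO' hne hRT⟩

end OrbitData

/-! ### The invariants of the algorithm -/

section Invariants

variable {A : Type*} [DecidableEq A] {n : ℕ} {R : Set (Fin n → A)}

theorem IsTuple.mono {S S' : Set A} (h : S ⊆ S') {a : List A} (ha : IsTuple R S a) :
    IsTuple R S' a :=
  ⟨ha.1, ha.2.1, fun x hx => h (ha.2.2 x hx)⟩

theorem IsTuple.univ {S : Set A} {a : List A} (ha : IsTuple R S a) : IsTuple R Set.univ a :=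
  ha.mono (Set.subset_univ S)

theorem IsTuple.map {γ : PartialMap A} (hγ : Set.InjOn γ.toFun γ.dom) {S : Set A} (hS : S ⊆ γ.dom)
    {a : List A} (ha : IsTuple R S a) : IsTuple R (γ.toFun '' S) (a.map γ.toFun) := by
  refine ⟨by simpa using ha.1, ?_, ?_⟩
  · exact ha.2.1.map_on fun x hx y hy h => hγ (hS (ha.2.2 x hx)) (hS (ha.2.2 y hy)) h
  · intro x hx
    obtain ⟨y, hy, rfl⟩ := List.mem_map.1 hx
    exact ⟨y, ha.2.2 y hy, rfl⟩

variable {L : Language} [L.Structure A]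

/-- If `c` and `d` are in the same block, then some partial isomorphism takes `c` to `d` and maps
each tuple over its domain into the block of that tuple. -/
def Orbits.Liftable (L : Language) [L.Structure A] (o : Orbits R) : Prop :=
  ∀ c d, o.Sim c d → ∃ δ : PartialMap A, IsPartialIso L δ ∧ (∀ x ∈ c, x ∈ δ.dom) ∧
    c.map δ.toFun = d ∧ ∀ e, IsTuple R δ.dom e → o.Sim e (e.map δ.toFun)

/-- The part of the invariant that concerns the orbits: there is at most one tagged orbit in each
isomorphism class. -/
structure Orbits.Invariant [Nonempty A] (τ : Vocabulary L) (o : Orbits R) : Prop where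
  good : o.Good τ
  lift : o.Liftable L
  sim_of_isomorphic : ∀ c d, o.Tagged c → o.Tagged d → Isomorphic L c d → o.Sim c d

/-- The invariant of a single stack entry. -/
structure FrameInvariant (L : Language) [L.Structure A] (o : Orbits R) (F : Frame A) :
    Prop where
  closed : ∀ (r : ℕ) (f : L.Functions r), Language.ClosedUnder f (F.S : Set A)
  tuple : ∀ a ∈ F.L, IsTuple R F.S a
  tagged : ∀ a, IsTuple R F.S a → a ∉ F.L → o.Tagged a
  generator : ∀ g ∈ F.G, o.Tagged g ∧ gen L g = F.S
  generated : (F.S : Set A) = Set.univ ∨ F.G.Nonempty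

/-- A tagged tuple shares its orbit with a generator of a stack entry, unless all tuples over the
subuniverse that it generates are tagged. -/
def Cover (L : Language) [L.Structure A] (o : Orbits R) (st : List (Frame A)) : Prop :=
  ∀ c, o.Tagged c →
    (∃ F ∈ st, ∃ g ∈ F.G, o.Sim c g) ∨ ∀ e, IsTuple R (gen L c) e → o.Tagged e

/-- The part of the invariant that concerns the stack. The subuniverses on it decrease strictly
towards the top, and the whole algebra is at the bottom until all tuples are tagged. -/
structure StackInvariant (L : Language) [L.Structure A] (o : Orbits R) (st : List (Frame A)) :
    Prop where
  frame : ∀ F ∈ st, FrameInvariant L o F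
  pairwise : st.Pairwise fun F F' => F.S ⊂ F'.S
  root : (∀ a, IsTuple R Set.univ a → o.Tagged a) ∨ ∃ F ∈ st, (F.S : Set A) = Set.univ
  cover : Cover L o st

variable {o o' : Orbits R}

theorem FrameInvariant.mono {F : Frame A} (h : FrameInvariant L o F)
    (ht : ∀ c, o.Tagged c → o'.Tagged c) : FrameInvariant L o' F :=
  { h with
    tagged := fun a ha hal => ht a (h.tagged a ha hal)
    generator := fun g hg => ⟨ht g (h.generator g hg).1, (h.generator g hg).2⟩ }

/-- A tuple on the list of the top entry may be removed once it is tagged. -/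
theorem StackInvariant.removeHead {S : Finset A} {a : List A} {l : List (List A)}
    {G : Set (List A)} {st : List (Frame A)} (h : StackInvariant L o (⟨S, a :: l, G⟩ :: st))
    (ha : o.Tagged a) : StackInvariant L o (⟨S, l, G⟩ :: st) := by
  obtain ⟨h1, h2, h3, h4⟩ := h
  have htop := h1 _ List.mem_cons_self
  refine ⟨?_, ?_, ?_, ?_⟩
  · rintro F hF
    rcases List.mem_cons.1 hF with rfl | hF
    · refine { htop with
        tuple := fun b hb => htop.tuple b (List.mem_cons_of_mem _ hb)
        tagged := fun b hb hbl => ?_ }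
      by_cases hba : b = a
      · exact hba ▸ ha
      · exact htop.tagged b hb (by simp [hba, hbl])
    · exact h1 F (List.mem_cons_of_mem _ hF)
  · exact List.pairwise_cons.2 (List.pairwise_cons.1 h2)
  · simpa using h3
  · intro c hc
    simpa using h4 c hc

variable [Nonempty A] {τ : Vocabulary L}

theorem Orbits.Invariant.isomorphic_of_sim (ho : o.Invariant τ) {c d : List A} (h : o.Sim c d) :
    Isomorphic L c d :=
  let ⟨δ, h1, h2, h3, _⟩ := ho.lift c d h
  ⟨δ, h1, h2, h3⟩

/-- If `c` and `d` are in the same orbit, then the isomorphism between the subuniverses that they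
generate transfers the property of being tagged. -/
theorem tagged_of_sim_gen (ho : o'.Good τ) (hl : o'.Liftable L)
    (ht : ∀ c, o.Tagged c → o'.Tagged c) {c d : List A} (hcd : o'.Sim c d)
    (hd : ∀ e, IsTuple R (gen L d) e → o.Tagged e) :
    ∀ e, IsTuple R (gen L c) e → o'.Tagged e := by
  obtain ⟨δ, h1, h2, rfl, h4⟩ := hl c d hcd
  intro e he
  have hsub : gen L c ⊆ δ.dom := gen_subset h2 h1.closed
  refine ho.tagged_of_sim (h4 e (he.mono hsub)) (ht _ (hd _ ?_))
  rw [gen_map h1 h2]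
  exact he.map h1.injOn hsub

theorem Cover.step {st st' : List (Frame A)} (h : Cover L o st) (ho : o'.Good τ)
    (hl : o'.Liftable L) (hs : ∀ c d, o.Sim c d → o'.Sim c d)
    (ht : ∀ c, o.Tagged c → o'.Tagged c) (hst : ∀ F ∈ st, ∃ F' ∈ st', F.G ⊆ F'.G)
    (hnew : ∀ c, o'.Tagged c →
      (∃ d, o'.Sim c d ∧ o.Tagged d) ∨ ∃ F ∈ st', ∃ g ∈ F.G, o'.Sim c g) :
    Cover L o' st' := by
  intro c hc
  rcases hnew c hc with ⟨d, hcd, hd⟩ | h'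
  · rcases h d hd with ⟨F, hF, g, hg, hdg⟩ | hall
    · obtain ⟨F', hF', hsub⟩ := hst F hF
      exact Or.inl ⟨F', hF', g, hsub hg, ho.sim_trans hcd (hs _ _ hdg)⟩
    · exact Or.inr (tagged_of_sim_gen ho hl ht hcd hall)
  · exact Or.inl h'

/-- An entry with an exhausted list may be deleted. -/
theorem StackInvariant.pop {S : Finset A} {G : Set (List A)} {st : List (Frame A)}
    (h : StackInvariant L o (⟨S, [], G⟩ :: st)) (ho : o.Invariant τ) : StackInvariant L o st := by
  obtain ⟨h1, h2, h3, h4⟩ := h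
  have htop := h1 _ List.mem_cons_self
  have hall : ∀ a, IsTuple R S a → o.Tagged a := fun a ha => htop.tagged a ha (by simp)
  refine ⟨fun F hF => h1 F (List.mem_cons_of_mem _ hF), (List.pairwise_cons.1 h2).2, ?_, ?_⟩
  · rcases h3 with h3 | ⟨F, hF, hFS⟩
    · exact Or.inl h3
    · rcases List.mem_cons.1 hF with rfl | hF
      · exact Or.inl fun a ha => hall a (by simpa only [hFS] using ha)
      · exact Or.inr ⟨F, hF, hFS⟩
  · intro c hc
    rcases h4 c hc with ⟨F, hF, g, hg, hcg⟩ | h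
    · rcases List.mem_cons.1 hF with rfl | hF
      · refine Or.inr (tagged_of_sim_gen ho.good ho.lift (fun _ => id) hcg fun e he => ?_)
        exact hall e (by simpa only [(htop.generator g hg).2] using he)
      · exact Or.inl ⟨F, hF, g, hg, hcg⟩
    · exact Or.inr h

/-- A successful call of the merging procedure preserves the invariant. -/
theorem MergeSpec.invariant {γ : PartialMap A} {l : List (List A)}
    (h : MergeSpec τ γ l o true o') (hl : IsTupleList R γ.dom l) (hγ : IsPartialIso L γ)
    (ho : o.Invariant τ) : o'.Invariant τ := by
  have hl' : ∀ a, a ∈ l ↔ IsTuple R γ.dom a := hl.2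
  have hlift : o'.Liftable L := by
    -- The pairs that can be lifted form an equivalence relation on the tuples.
    have := h.sim_le (fun c d => o'.Sim c d ∧ ∃ δ : PartialMap A, IsPartialIso L δ ∧
      (∀ x ∈ c, x ∈ δ.dom) ∧ c.map δ.toFun = d ∧
        ∀ e, IsTuple R δ.dom e → o'.Sim e (e.map δ.toFun)) ?_ ?_ ?_ ?_
    · exact fun c d hcd => (this c d hcd).2
    · intro c d hcd
      obtain ⟨δ, h1, h2, h3, h4⟩ := ho.lift c d hcd
      exact ⟨h.sim_mono _ _ hcd, δ, h1, h2, h3, fun e he => h.sim_mono _ _ (h4 e he)⟩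
    · intro c hc
      exact ⟨h.of_true rfl c hc, γ, hγ, ((hl' c).1 hc).2.2, rfl,
        fun e he => h.of_true rfl e ((hl' e).2 he)⟩
    · rintro c d ⟨hcd, δ, h1, h2, rfl, h4⟩
      refine ⟨hcd.symm, δ.inv, h1.inv, fun x hx => ?_, h1.map_inv h2, fun e he => ?_⟩
      · obtain ⟨y, hy, rfl⟩ := List.mem_map.1 hx
        exact ⟨y, h2 y hy, rfl⟩
      · have he' : ∀ x ∈ e, δ.inv.toFun x ∈ δ.dom ∧ δ.toFun (δ.inv.toFun x) = x := by
          intro x hx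
          obtain ⟨y, hy, rfl⟩ := he.2.2 x hx
          rw [h1.inv_apply hy]
          exact ⟨hy, rfl⟩
        have hmap : (e.map δ.inv.toFun).map δ.toFun = e := by
          rw [List.map_map]
          exact (List.map_congr_left fun x hx => (he' x hx).2).trans (List.map_id e)
        have := h4 (e.map δ.inv.toFun) ⟨by simpa using he.1, ?_, ?_⟩
        · rw [hmap] at this
          exact this.symm
        · exact List.Nodup.of_map δ.toFun (by rw [hmap]; exact he.2.1)
        · intro x hx
          obtain ⟨y, hy, rfl⟩ := List.mem_map.1 hx
          exact (he' y hy).1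
    · rintro c d e ⟨hcd, δ, h1, h2, rfl, h4⟩ ⟨hde, δ', h1', h2', rfl, h4'⟩
      refine ⟨h.good.sim_trans hcd hde, δ'.comp δ, h1'.comp h1,
        fun x hx => ⟨h2 x hx, h2' _ (List.mem_map_of_mem hx)⟩, by rw [List.map_map]; rfl, ?_⟩
      intro e he
      have he1 : IsTuple R δ.dom e := he.mono fun x hx => hx.1
      have he2 : IsTuple R δ'.dom (e.map δ.toFun) := by
        have := he.map (γ := δ) h1.injOn fun x hx => hx.1
        refine this.mono ?_
        rintro _ ⟨x, hx, rfl⟩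
        exact hx.2
      have := h.good.sim_trans (h4 e he1) (h4' _ he2)
      rwa [List.map_map] at this
  refine ⟨h.good, hlift, fun c d hc hd hcd => ?_⟩
  obtain ⟨c', hcc', hc'⟩ := h.exists_tagged c hc
  obtain ⟨d', hdd', hd'⟩ := h.exists_tagged d hd
  have hiso : ∀ a b, o'.Sim a b → Isomorphic L a b := fun a b hab =>
    let ⟨δ, h1, h2, h3, _⟩ := hlift a b hab
    ⟨δ, h1, h2, h3⟩
  have := ho.sim_of_isomorphic c' d' hc' hd'
    (((hiso _ _ hcc').symm.trans hcd).trans (hiso _ _ hdd'))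
  exact h.good.sim_trans (h.good.sim_trans hcc' (h.sim_mono _ _ this)) hdd'.symm

theorem MergeSpec.stackInvariant {γ : PartialMap A} {l : List (List A)} {st : List (Frame A)}
    (h : MergeSpec τ γ l o true o') (ho' : o'.Invariant τ) (hst : StackInvariant L o st) :
    StackInvariant L o' st where
  frame F hF := (hst.frame F hF).mono h.tagged_mono
  pairwise := hst.pairwise
  root := hst.root.imp_left fun h1 a ha => h.tagged_mono a (h1 a ha)
  cover := hst.cover.step h.good ho'.lift h.sim_mono h.tagged_mono
    (fun F hF => ⟨F, hF, subset_rfl⟩) fun c hc => Or.inl (h.exists_tagged c hc)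

/-- Tagging the orbit of a tuple that is not isomorphic to a tagged one preserves the invariant. -/
theorem Orbits.Invariant.tagOrbit (ho : o.Invariant τ) {a : List A} {O : Orbit R}
    (hO : o.IsOrbitOf a O) {P : Finset (Finset ℕ)} {U : List A} (h : IsoTypeReturns τ a P U)
    (hnew : ∀ b, o.Tagged b → ¬ Isomorphic L b a) :
    (o.replace a.length {O} (O.tag P U)).Invariant τ := by
  obtain ⟨h1, h2, h3⟩ := ho.good.tagOrbit hO h
  refine ⟨h1, fun c d hcd => ?_, fun c d hc hd hcd => ?_⟩
  · simp only [h2] at hcd ⊢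
    exact ho.lift c d hcd
  · rw [h2]
    rcases (h3 c).1 hc with hc | hc <;> rcases (h3 d).1 hd with hd | hd
    · exact ho.sim_of_isomorphic c d hc hd hcd
    · exact absurd (hcd.trans (ho.isomorphic_of_sim hd)) (hnew c hc)
    · exact absurd (hcd.symm.trans (ho.isomorphic_of_sim hc)) (hnew d hd)
    · exact ho.good.sim_trans hc hd.symm

/-- If the orbit of `b` is tagged and `b` is isomorphic to `a`, then the tag is the type of `a`. -/
theorem Orbits.Invariant.T_eq (ho : o.Invariant τ) {a b : List A} {O : Orbit R}
    (hO : o.IsOrbitOf b O) (hT : O.T ≠ none) (hab : Isomorphic L b a) {P : Finset (Finset ℕ)}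
    {U : List A} (h : IsoTypeReturns τ a P U) : O.T = some P := by
  obtain ⟨P', hP'⟩ := Option.ne_none_iff_exists'.1 hT
  obtain ⟨U', -, c, hc, hc'⟩ := ho.good.tag _ O hO.1 P' hP'
  obtain ⟨γ, hγ, hcγ, rfl⟩ := (ho.isomorphic_of_sim
    ⟨O, ho.good.isOrbitOf_of_mem hO.1 hc, hO⟩).trans hab
  rw [hP', ((hc'.map hγ hcγ).unique h).1]

/-- If a tuple generates the subuniverse of the top entry of the stack and is not tagged, and if no
generator of the entry has its type, then it is not isomorphic to any tagged tuple. For a tagged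
tuple that is isomorphic to it shares its orbit with a generator of the same entry, or else all
tuples over the subuniverse that it generates are tagged, whence the orbit of a generator of the
entry meets that subuniverse, and the tuple itself is tagged. -/
theorem not_isomorphic_of_generators [Finite A] {S : Finset A} {a : List A} {l : List (List A)}
    {G : Set (List A)} {st : List (Frame A)} (ho : o.Invariant τ)
    (hst : StackInvariant L o (⟨S, a :: l, G⟩ :: st)) (ha : ¬ o.Tagged a) (hS : gen L a = S)
    {P : Finset (Finset ℕ)} {U : List A} (h : IsoTypeReturns τ a P U)
    (hG : ∀ g ∈ G, ∀ O : Orbit R, o.IsOrbitOf g O → O.T ≠ some P) :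
    ∀ b, o.Tagged b → ¬ Isomorphic L b a := by
  intro b hb hba
  have htop := hst.frame _ List.mem_cons_self
  rcases hst.cover b hb with ⟨F, hF, g, hg, hbg⟩ | hall
  · have hFS : F = ⟨S, a :: l, G⟩ := by
      rcases List.mem_cons.1 hF with rfl | hF'
      · rfl
      · have hlt := Finset.card_lt_card ((List.pairwise_cons.1 hst.pairwise).1 F hF')
        have h1 := (ho.isomorphic_of_sim hbg).ncard_gen
        rw [hba.ncard_gen, hS, ((hst.frame F hF).generator g hg).2, Set.ncard_coe_finset,
          Set.ncard_coe_finset] at h1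
        exact absurd h1 hlt.ne
    subst hFS
    obtain ⟨O, hO, hT⟩ := ho.good.tagged_of_sim hbg.symm hb
    exact hG g hg O hO
      (ho.T_eq hO hT ((ho.isomorphic_of_sim hbg).symm.trans hba) h)
  · have haS : IsTuple R S a := htop.tuple a List.mem_cons_self
    rcases htop.generated with huniv | ⟨g, hg⟩
    · have hb_univ : gen L b = Set.univ := by
        refine Set.eq_of_subset_of_ncard_le (Set.subset_univ _) ?_
        rw [hba.ncard_gen, hS, huniv]
      exact ha (hall a (by rw [hb_univ]; exact haS.univ))
    · obtain ⟨hgtag, hgS⟩ := htop.generator g hg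
      have hgt := ho.good.tuple_of_tagged hgtag
      obtain ⟨γ, hγ, haγ, rfl⟩ := hba.symm
      have hsub : gen L a ⊆ γ.dom := gen_subset haγ hγ.closed
      have hggen : gen L g = gen L a := hgS.trans hS.symm
      have hga : ∀ x ∈ g, x ∈ gen L a := fun x hx => hggen ▸ mem_gen_of_mem hx
      rw [gen_map hγ haγ] at hall
      have hgt' : IsTuple R (gen L a) g := ⟨hgt.1, hgt.2.1, hga⟩
      have hγg := hall _ (hgt'.map hγ.injOn hsub)
      have hsim := ho.sim_of_isomorphic g _ hgtag hγg ⟨γ, hγ, fun x hx => hsub (hga x hx), rfl⟩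
      obtain ⟨δ, hδ, hgδ, hδg, hδe⟩ := ho.lift _ _ hsim
      have hsubδ : gen L a ⊆ δ.dom := hggen ▸ gen_subset hgδ hδ.closed
      have haδ : a.map δ.toFun = a.map γ.toFun := List.map_congr_left fun x hx =>
        eqOn_gen hδ hγ hgδ (fun x hx => hsub (hga x hx)) hδg
          (hggen ▸ mem_gen_of_mem hx)
      have := hδe a ⟨haS.1, haS.2.1, fun x hx => hsubδ (mem_gen_of_mem hx)⟩
      rw [haδ] at this
      exact ha (ho.good.tagged_of_sim this hb)

end Invariants

/-! ### Finite sets of tuples -/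

section Steps

variable {A : Type*} [DecidableEq A] {n : ℕ} {R : Set (Fin n → A)}

theorem finite_isTuple [Finite A] (S : Set A) : {a | IsTuple R S a}.Finite := by
  have := Fintype.ofFinite A
  exact (List.finite_length_le A (Fintype.card A)).subset fun a ha => ha.2.1.length_le_card

theorem exists_isTupleList [Finite A] (R : Set (Fin n → A)) (S : Set A) :
    ∃ l, IsTupleList R S l := by
  refine ⟨(finite_isTuple (R := R) S).toFinset.toList, Finset.nodup_toList _, fun a => ?_⟩
  rw [Finset.mem_toList, Set.Finite.mem_toFinset]
  rfl

/-- The number of tuples whose type is unknown. -/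
noncomputable def Orbits.untagged (o : Orbits R) : ℕ :=
  {a | IsTuple R Set.univ a ∧ ¬ o.Tagged a}.ncard

theorem Orbits.untagged_le [Finite A] {o o' : Orbits R} (h : ∀ c, o.Tagged c → o'.Tagged c) :
    o'.untagged ≤ o.untagged :=
  Set.ncard_le_ncard (fun c hc => ⟨hc.1, fun ht => hc.2 (h c ht)⟩)
    ((finite_isTuple Set.univ).subset fun _ hc => hc.1)

theorem Orbits.untagged_lt [Finite A] {o o' : Orbits R} (h : ∀ c, o.Tagged c → o'.Tagged c)
    {a : List A} (ha : IsTuple R Set.univ a) (hao : ¬ o.Tagged a) (hao' : o'.Tagged a) :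
    o'.untagged < o.untagged :=
  Set.ncard_lt_ncard ⟨fun c hc => ⟨hc.1, fun ht => hc.2 (h c ht)⟩,
    fun hsub => (hsub (show a ∈ _ from ⟨ha, hao⟩)).2 hao'⟩
    ((finite_isTuple Set.univ).subset fun _ hc => hc.1)

/-! ### Steps of the algorithm -/

variable {L : Language} [L.Structure A] [Nonempty A] {τ : Vocabulary L} {o : Orbits R}

/-- The invariant of the algorithm. Merging takes place only along partial isomorphisms that take
the tuple just removed from the top entry to a tagged tuple; for the returned value `true`, the
orbits are the isomorphism classes. -/
def State.Invariant (τ : Vocabulary L) : State R → Prop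
  | .loop o st => o.Invariant τ ∧ StackInvariant L o st
  | .merging γ o st => o.Invariant τ ∧ IsPartialIso L γ ∧ γ.dom.Nonempty ∧
      ∃ S a l G rest, st = ⟨S, l, G⟩ :: rest ∧ StackInvariant L o (⟨S, a :: l, G⟩ :: rest) ∧
        IsTuple R γ.dom a ∧ o.Tagged (a.map γ.toFun)
  | .halt b o => (b = true ↔ QfDefinable L R) ∧ (b = true → o.Good τ ∧
      ∀ c d, IsTuple R Set.univ c → IsTuple R Set.univ d → (o.Sim c d ↔ Isomorphic L c d))

theorem invariant_initOrbits : (initOrbits R).Invariant τ := by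
  have hO : ∀ (a : List A) (O : Orbit R), (initOrbits R).IsOrbitOf a O ↔
      IsTuple R Set.univ a ∧ O = ⟨{a}, relType R a, none, none⟩ := by
    intro a O
    constructor
    · rintro ⟨⟨h1, b, h2, h3, rfl⟩, h4⟩
      obtain rfl : a = b := h4
      exact ⟨⟨h1, h3, fun _ _ => trivial⟩, rfl⟩
    · rintro ⟨h, rfl⟩
      exact ⟨⟨h.1, a, rfl, h.2.1, rfl⟩, rfl⟩
  have htag : ∀ a, ¬ (initOrbits R).Tagged a := by
    rintro a ⟨O, h1, h2⟩
    obtain ⟨-, rfl⟩ := (hO a O).1 h1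
    exact h2 rfl
  refine ⟨⟨?_, ?_, ?_, ?_, ?_, ?_⟩, ?_, ?_⟩
  · rintro k _ ⟨h1, b, rfl, h3, rfl⟩ c rfl
    exact ⟨rfl, h1, h3, fun _ _ => trivial⟩
  · rintro k _ ⟨h1, b, rfl, h3, rfl⟩
    exact ⟨b, rfl⟩
  · exact fun a ha => ⟨_, (hO a _).2 ⟨ha, rfl⟩⟩
  · intro a O O' h h'
    rw [((hO a O).1 h).2, ((hO a O').1 h').2]
  · intro a O h
    rw [((hO a O).1 h).2]
  · rintro k _ ⟨h1, b, rfl, h3, rfl⟩ P hP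
    exact absurd hP (by simp)
  · rintro c d ⟨O, hc, hd⟩
    obtain ⟨-, rfl⟩ := (hO c _).1 hc
    obtain rfl : d = c := hd.2
    refine ⟨_, isPartialIso_id, fun _ _ => trivial, List.map_id d, fun e he => ?_⟩
    rw [show e.map (id : A → A) = e from List.map_id e]
    exact ⟨_, (hO e _).2 ⟨he, rfl⟩, (hO e _).2 ⟨he, rfl⟩⟩
  · exact fun c d hc => absurd hc (htag c)

theorem IsInitial.invariant [Fintype A] {s : State R} (h : IsInitial R s) : s.Invariant τ := by
  obtain ⟨l, hl, rfl⟩ := h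
  refine ⟨invariant_initOrbits, ?_, List.pairwise_singleton _ _,
    Or.inr ⟨_, List.mem_cons_self, Finset.coe_univ⟩, ?_⟩
  · intro F hF
    obtain rfl := List.mem_singleton.1 hF
    refine ⟨fun r f x _ => by simp, fun a ha => ?_, fun a ha hal => ?_, fun g hg => hg.elim,
      Or.inl Finset.coe_univ⟩
    · exact ((hl.2 a).1 ha).imp_right fun h => h.imp_right fun h x hx => by simp
    · exact absurd ((hl.2 a).2 ha.univ) hal
  · rintro c ⟨O, ⟨⟨-, b, -, -, rfl⟩, -⟩, h⟩
    exact absurd rfl h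

/-- If a tagged orbit has the type of an untagged tuple, then the lists returned by `IsoType`
define a partial isomorphism that takes the tuple to a tagged one. -/
theorem Orbits.Invariant.mapOfLists [IsEmpty L.Constants] (ho : o.Invariant τ) {a : List A}
    (hat : IsTuple R Set.univ a) (ha : ¬ o.Tagged a) {P : Finset (Finset ℕ)} {U U' : List A}
    (h : IsoTypeReturns τ a P U) {k : ℕ} {O : Orbit R} (hO : O ∈ o k) (hT : O.T = some P)
    (hU : O.U = some U') :
    IsPartialIso L (mapOfLists U U') ∧ (mapOfLists U U').dom.Nonempty ∧
      IsTuple R (mapOfLists U U').dom a ∧ o.Tagged (a.map (mapOfLists U U').toFun) := by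
  obtain ⟨U'', hU'', c, hc, hret⟩ := ho.good.tag k O hO P hT
  obtain rfl : U' = U'' := Option.some.inj (hU.symm.trans hU'')
  obtain ⟨h1, h2, h3⟩ := h.isPartialIso_mapOfLists hret
  have hct : o.Tagged c := ⟨O, ho.good.isOrbitOf_of_mem hO hc, by simp [hT]⟩
  refine ⟨h1, ?_, ⟨hat.1, hat.2.1, h2⟩, by rwa [h3]⟩
  cases a with
  | nil =>
    -- The empty tuple is alone in its isomorphism class.
    obtain rfl : [] = c := h3
    exact absurd hct ha
  | cons x a => exact ⟨x, h2 x List.mem_cons_self⟩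

/-- Let the orbit of the first tuple `a` of the top entry be tagged. The invariant holds for each
stack on which `a` is a generator of an entry. -/
theorem StackInvariant.tagOrbit {S : Finset A} {a : List A} {l : List (List A)}
    {G : Set (List A)} {st st' : List (Frame A)} {o' : Orbits R}
    (hst : StackInvariant L o (⟨S, a :: l, G⟩ :: st)) (ho' : o'.Invariant τ)
    (hs : ∀ b c, o'.Sim b c ↔ o.Sim b c) (ht : ∀ b, o'.Tagged b ↔ o.Tagged b ∨ o.Sim b a)
    (hframe : ∀ F ∈ st', FrameInvariant L o' F)
    (hpw : st'.Pairwise fun F F' => F.S ⊂ F'.S)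
    (hsub : ∀ F ∈ (⟨S, a :: l, G⟩ : Frame A) :: st, ∃ F' ∈ st', F.S = F'.S ∧ F.G ⊆ F'.G)
    (hgen : ∃ F ∈ st', a ∈ F.G) : StackInvariant L o' st' := by
  refine ⟨hframe, hpw, ?_, ?_⟩
  · rcases hst.root with h | ⟨F, hF, hFS⟩
    · exact Or.inl fun b hb => (ht b).2 (Or.inl (h b hb))
    · obtain ⟨F', hF', hSS', -⟩ := hsub F hF
      exact Or.inr ⟨F', hF', hSS' ▸ hFS⟩
  · refine hst.cover.step ho'.good ho'.lift (fun b c => (hs b c).2)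
      (fun b hb => (ht b).2 (Or.inl hb)) (fun F hF => ?_) fun c hc => ?_
    · obtain ⟨F', hF', -, hG⟩ := hsub F hF
      exact ⟨F', hF', hG⟩
    · rcases (ht c).1 hc with h | h
      · exact Or.inl ⟨c, ho'.good.sim_refl (ho'.good.tuple_of_tagged hc), h⟩
      · obtain ⟨F, hF, haF⟩ := hgen
        exact Or.inr ⟨F, hF, a, haF, (hs c a).2 h⟩

theorem Orbits.Good.not_tagged (ho : o.Good τ) {a : List A} {O : Orbit R} (hO : o.IsOrbitOf a O)
    (hT : O.T = none) : ¬ o.Tagged a := by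
  rintro ⟨O', hO', hT'⟩
  rw [ho.unique _ _ _ hO' hO] at hT'
  exact hT' hT

theorem Step.invariant [Fintype A] [L.IsAlgebraic] [IsEmpty L.Constants] {s s' : State R}
    (h : Step τ s s') (hs : s.Invariant τ) : s'.Invariant τ := by
  cases h with
  | finish o =>
    obtain ⟨ho, hst⟩ := hs
    have hall : ∀ a, IsTuple R Set.univ a → o.Tagged a := hst.root.resolve_right (by simp)
    have hsim : ∀ c d, IsTuple R Set.univ c → IsTuple R Set.univ d →
        (o.Sim c d ↔ Isomorphic L c d) := fun c d hc hd =>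
      ⟨ho.isomorphic_of_sim, ho.sim_of_isomorphic c d (hall c hc) (hall d hd)⟩
    refine ⟨iff_of_true rfl (qfDefinable_iff_relType.2 fun a b h1 h2 hab => ?_),
      fun _ => ⟨ho.good, hsim⟩⟩
    have ha : IsTuple R Set.univ a := ⟨h1, h2, fun _ _ => trivial⟩
    have hb : IsTuple R Set.univ b := by
      obtain ⟨γ, hγ, haγ, rfl⟩ := hab
      exact (IsTuple.map hγ.injOn subset_rfl ⟨h1, h2, haγ⟩).univ
    obtain ⟨O, hO, hO'⟩ := (hsim a b ha hb).2 hab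
    rw [ho.good.relType_eq a O hO, ho.good.relType_eq b O hO']
  | pop o S G st => exact ⟨hs.1, hs.2.pop hs.1⟩
  | known O hO hT => exact ⟨hs.1, hs.2.removeHead ⟨O, hO, hT⟩⟩
  | @sameFound o S a l G st P U U' O g O' hO hT h hlen hg hO' hT' hU' =>
    obtain ⟨ho, hst⟩ := hs
    have hat := ((hst.frame _ List.mem_cons_self).tuple a List.mem_cons_self).univ
    obtain ⟨h1, h2, h3, h4⟩ :=
      ho.mapOfLists hat (ho.good.not_tagged hO hT) h hO'.1 hT' hU'
    exact ⟨ho, h1, h2, S, a, l, G, st, rfl, hst, h3, h4⟩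
  | @sameNew o S a l G st P U O hO hT h hlen hG =>
    obtain ⟨ho, hst⟩ := hs
    have htop := hst.frame _ List.mem_cons_self
    have haS := htop.tuple a List.mem_cons_self
    have hgen : gen L a = S := by
      have hUS : U.toFinset ⊆ S := fun x hx =>
        gen_subset haS.2.2 htop.closed (h.mem_iff.1 (List.mem_toFinset.1 hx))
      have := Finset.eq_of_subset_of_card_le hUS
        (by rw [List.toFinset_card_of_nodup h.nodup, hlen])
      rw [← this]
      ext x
      simpa using h.mem_iff.symm
    obtain ⟨-, h2, h3⟩ := ho.good.tagOrbit hO h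
    have ho' := ho.tagOrbit hO h
      (not_isomorphic_of_generators ho hst (ho.good.not_tagged hO hT) hgen h hG)
    have hta := (h3 a).2 (Or.inr (ho.good.sim_refl haS.univ))
    refine ⟨ho', StackInvariant.removeHead (a := a) ?_ hta⟩
    refine hst.tagOrbit ho' h2 h3 ?_ ?_ ?_ ⟨_, List.mem_cons_self, Set.mem_insert _ _⟩
    · intro F hF
      rcases List.mem_cons.1 hF with rfl | hF
      · have htop' := htop.mono fun c hc => (h3 c).2 (Or.inl hc)
        refine { htop' with
          generator := ?_
          generated := Or.inr ⟨a, Set.mem_insert _ _⟩ }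
        rintro g (rfl | hg)
        · exact ⟨hta, hgen⟩
        · exact htop'.generator g hg
      · exact (hst.frame F (List.mem_cons_of_mem _ hF)).mono fun c hc => (h3 c).2 (Or.inl hc)
    · exact List.pairwise_cons.2 (List.pairwise_cons.1 hst.pairwise)
    · intro F hF
      rcases List.mem_cons.1 hF with rfl | hF
      · exact ⟨_, List.mem_cons_self, rfl, Set.subset_insert _ _⟩
      · exact ⟨F, List.mem_cons_of_mem _ hF, rfl, subset_rfl⟩
  | @smallerFound o S a l G st P U U' O O' hO hT h hlen hO' hT' hU' =>
    obtain ⟨ho, hst⟩ := hs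
    have hat := ((hst.frame _ List.mem_cons_self).tuple a List.mem_cons_self).univ
    obtain ⟨h1, h2, h3, h4⟩ :=
      ho.mapOfLists hat (ho.good.not_tagged hO hT) h hO' hT' hU'
    exact ⟨ho, h1, h2, S, a, l, G, st, rfl, hst, h3, h4⟩
  | @smallerNew o S a l G st P U l' st' O hO hT h hlen hG hl' hpush =>
    obtain ⟨ho, hst⟩ := hs
    have htop := hst.frame _ List.mem_cons_self
    have haS := htop.tuple a List.mem_cons_self
    have hgen : gen L a = U.toFinset := by
      ext x
      simpa using h.mem_iff.symm
    have hUS : U.toFinset ⊂ S := by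
      refine (Finset.ssubset_iff_subset_ne).2 ⟨fun x hx => ?_, ?_⟩
      · exact gen_subset haS.2.2 htop.closed (h.mem_iff.1 (List.mem_toFinset.1 hx))
      · rintro rfl
        exact hlen (List.toFinset_card_of_nodup h.nodup).symm
    obtain ⟨-, h2, h3⟩ := ho.good.tagOrbit hO h
    have ho' := ho.tagOrbit hO h fun b ⟨Q, hQ, hQT⟩ hba => by
      have hlen : b.length = a.length := by
        obtain ⟨γ, -, -, rfl⟩ := hba
        simp
      exact hG Q (hlen ▸ hQ.1) (ho.T_eq hQ hQT hba h)
    have hta := (h3 a).2 (Or.inr (ho.good.sim_refl haS.univ))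
    have htop' := htop.mono fun c hc => (h3 c).2 (Or.inl hc)
    have hold : FrameInvariant L (o.replace a.length {O} (O.tag P U)) ⟨S, l, G⟩ :=
      { htop' with
        tuple := fun b hb => htop'.tuple b (List.mem_cons_of_mem _ hb)
        tagged := fun b hb hbl => by
          by_cases hba : b = a
          · exact hba ▸ hta
          · exact htop'.tagged b hb (by simp [hba, hbl]) }
    -- The invariant for the stack with a new entry, which may have any list that contains the
    -- untagged tuples over its subuniverse.
    have key : ∀ l'' : List (List A), (∀ b ∈ l'', IsTuple R U.toFinset b) →
        (∀ b, IsTuple R U.toFinset b → b ∉ l'' →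
          (o.replace a.length {O} (O.tag P U)).Tagged b) →
        StackInvariant L (o.replace a.length {O} (O.tag P U))
          (⟨U.toFinset, l'', {a}⟩ :: ⟨S, l, G⟩ :: st) := by
      intro l'' hl1 hl2
      refine hst.tagOrbit ho' h2 h3 ?_ ?_ ?_ ⟨_, List.mem_cons_self, rfl⟩
      · intro F hF
        rcases List.mem_cons.1 hF with rfl | hF
        · refine ⟨?_, hl1, hl2, ?_, Or.inr ⟨a, rfl⟩⟩
          · rw [← hgen]
            exact gen_closed a
          · rintro g rfl
            exact ⟨hta, hgen⟩
        · rcases List.mem_cons.1 hF with rfl | hF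
          · exact hold
          · exact (hst.frame F (List.mem_cons_of_mem _ hF)).mono fun c hc => (h3 c).2 (Or.inl hc)
      · have hpw := List.pairwise_cons.1 hst.pairwise
        refine List.pairwise_cons.2 ⟨fun F hF => ?_, List.pairwise_cons.2 hpw⟩
        rcases List.mem_cons.1 hF with rfl | hF
        · exact hUS
        · exact hUS.trans (hpw.1 F hF)
      · intro F hF
        rcases List.mem_cons.1 hF with rfl | hF
        · exact ⟨_, List.mem_cons_of_mem _ List.mem_cons_self, rfl, subset_rfl⟩
        · exact ⟨F, List.mem_cons_of_mem _ (List.mem_cons_of_mem _ hF), rfl, subset_rfl⟩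
    have hUcoe : ((U.toFinset : Finset A) : Set A) = {x | x ∈ U} := by
      ext x
      simp
    refine ⟨ho', ?_⟩
    cases hpush with
    | push =>
      refine key l' (fun b hb => ?_) fun b hb hbl => ?_
      · rw [hUcoe]
        exact (hl'.2 b).1 hb
      · rw [hUcoe] at hb
        exact absurd ((hl'.2 b).2 hb) hbl
    | drop =>
      -- All tuples over the old subuniverse are tagged, hence so are those over the new one.
      refine (key [] (by simp) fun b hb _ => ?_).pop ho'
      exact hold.tagged b (hb.mono (Finset.coe_subset.2 hUS.1)) (by simp)
  | mergeTrue hl hm =>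
    obtain ⟨ho, hγ, -, S, a, l', G, rest, rfl, hst, ha, hta⟩ := hs
    have hspec := hm.mergeSpec ho.good
    have ho' := hspec.invariant hl hγ ho
    exact ⟨ho', (hspec.stackInvariant ho' hst).removeHead
      (hspec.good.tagged_of_sim (hspec.of_true rfl a ((hl.2 a).2 ha)) (hspec.tagged_mono _ hta))⟩
  | mergeFalse hl hm =>
    obtain ⟨ho, hγ, -⟩ := hs
    obtain ⟨c, hc, hne⟩ := (hm.mergeSpec ho.good).of_false rfl
    obtain ⟨h1, h2, h3⟩ := (hl.2 c).1 hc
    refine ⟨iff_of_false (by simp) fun hR => hne ?_, by simp⟩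
    exact qfDefinable_iff_relType.1 hR _ _ h1 h2 ⟨_, hγ, h3, rfl⟩

theorem Reachable.invariant [Fintype A] [L.IsAlgebraic] [IsEmpty L.Constants] {s : State R}
    (h : Reachable τ R s) : s.Invariant τ := by
  obtain ⟨s₀, h0, h⟩ := h
  induction h with
  | refl => exact h0.invariant
  | tail _ hstep ih => exact hstep.invariant ih

/-- A step is possible in every state that has not halted. -/
theorem State.Invariant.exists_step [Fintype A] {s : State R} (hs : s.Invariant τ) :
    (∃ s', Step τ s s') ∨ ∃ b o, s = State.halt b o := by
  match s, hs with
  | .halt b o, _ => exact Or.inr ⟨b, o, rfl⟩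
  | .merging γ o st, ⟨ho, hγ, _, _⟩ =>
    left
    obtain ⟨l, hl⟩ := exists_isTupleList R γ.dom
    obtain ⟨b, o', h⟩ := ho.good.exists_tryMerge (γ := γ) (l := l) fun c hc => by
      have hc : IsTuple R γ.dom c := (hl.2 c).1 hc
      exact ⟨hc.univ, (hc.map hγ.injOn subset_rfl).univ⟩
    cases b with
    | true => exact ⟨_, Step.mergeTrue hl h⟩
    | false => exact ⟨_, Step.mergeFalse hl h⟩
  | .loop o [], _ => exact Or.inl ⟨_, Step.finish o⟩
  | .loop o (⟨S, [], G⟩ :: st), _ => exact Or.inl ⟨_, Step.pop o S G st⟩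
  | .loop o (⟨S, a :: l, G⟩ :: st), ⟨ho, hst⟩ =>
    left
    have hat := ((hst.frame _ List.mem_cons_self).tuple a List.mem_cons_self).univ
    obtain ⟨O, hO⟩ := ho.good.exists_orbit a hat
    by_cases hT : O.T = none
    · obtain ⟨P, U, h⟩ := exists_isoTypeReturns τ a
      by_cases hlen : U.length = S.card
      · by_cases hG : ∀ g ∈ G, ∀ O' : Orbit R, o.IsOrbitOf g O' → O'.T ≠ some P
        · exact ⟨_, Step.sameNew O hO hT h hlen hG⟩
        · push Not at hG
          obtain ⟨g, hg, O', hO', hT'⟩ := hG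
          obtain ⟨U', hU', -⟩ := ho.good.tag _ O' hO'.1 P hT'
          exact ⟨_, Step.sameFound O g O' hO hT h hlen hg hO' hT' hU'⟩
      · by_cases hG : ∀ O' ∈ o a.length, O'.T ≠ some P
        · obtain ⟨l', hl'⟩ := exists_isTupleList R {x | x ∈ U}
          exact ⟨_, Step.smallerNew O hO hT h hlen hG hl' (PushResult.push _ _)⟩
        · push Not at hG
          obtain ⟨O', hO', hT'⟩ := hG
          obtain ⟨U', hU', -⟩ := ho.good.tag _ O' hO' P hT'
          exact ⟨_, Step.smallerFound O O' hO hT h hlen hO' hT' hU'⟩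
    · exact ⟨_, Step.known O hO hT⟩

/-! ### Termination -/

/-- The amount of work left on the stack. -/
def stackWeight (st : List (Frame A)) : ℕ :=
  (st.map fun F => 2 * F.L.length + 2).sum

/-- A quantity that decreases lexicographically with each step. -/
noncomputable def State.weight : State R → ℕ × ℕ
  | .loop o st => (o.untagged, 1 + stackWeight st)
  | .merging _ o st => (o.untagged, 2 + stackWeight st)
  | .halt _ _ => (0, 0)

theorem Step.weight_lt [Fintype A] {s s' : State R} (h : Step τ s s') (hs : s.Invariant τ) :
    Prod.Lex (· < ·) (· < ·) s'.weight s.weight := by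
  have hlex : ∀ {u u' w w' : ℕ}, u' ≤ u → w' < w →
      Prod.Lex (· < ·) (· < ·) (u', w') (u, w) := fun {u u' w w'} hu hw => by
    rcases hu.lt_or_eq with hu | rfl
    · exact Prod.Lex.left _ _ hu
    · exact Prod.Lex.right _ hw
  cases h with
  | finish o => exact hlex (Nat.zero_le _) (by omega)
  | pop => exact hlex le_rfl (by simp [stackWeight])
  | known => exact hlex le_rfl (by simp [stackWeight])
  | sameFound =>
    refine hlex le_rfl ?_
    simp only [stackWeight, List.map_cons, List.sum_cons, List.length_cons]
    omega
  | smallerFound =>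
    refine hlex le_rfl ?_
    simp only [stackWeight, List.map_cons, List.sum_cons, List.length_cons]
    omega
  | sameNew O hO hT h =>
    refine hlex (Orbits.untagged_le fun c hc => ?_) (by simp [stackWeight])
    exact ((hs.1.good.tagOrbit hO h).2.2 c).2 (Or.inl hc)
  | @smallerNew o S a l G st P U l' st' O hO hT h hlen hG hl' hpush =>
    have h3 := (hs.1.good.tagOrbit hO h).2.2
    have hat := (hs.1.good.tuple _ O hO.1 a hO.2).2
    exact Prod.Lex.left _ _ (Orbits.untagged_lt (fun c hc => (h3 c).2 (Or.inl hc)) hat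
      (hs.1.good.not_tagged hO hT) ((h3 a).2 (Or.inr (hs.1.good.sim_refl hat))))
  | mergeTrue hl hm =>
    exact hlex (Orbits.untagged_le (hm.mergeSpec hs.1.good).tagged_mono) (by omega)
  | mergeFalse => exact hlex (Nat.zero_le _) (by omega)

theorem not_exists_infinite_execution [Fintype A] [L.IsAlgebraic] [IsEmpty L.Constants] :
    ¬ ∃ s : ℕ → State R, IsInitial R (s 0) ∧ ∀ i, Step τ (s i) (s (i + 1)) := by
  rintro ⟨s, h0, hstep⟩
  have hinv : ∀ i, (s i).Invariant τ := by
    intro i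
    induction i with
    | zero => exact h0.invariant
    | succ i ih => exact (hstep i).invariant ih
  have hwf : WellFounded (Prod.Lex (· < ·) (· < ·) : ℕ × ℕ → ℕ × ℕ → Prop) :=
    WellFounded.prod_lex wellFounded_lt wellFounded_lt
  obtain ⟨_, ⟨i, rfl⟩, hi⟩ := hwf.has_min (Set.range fun i => (s i).weight) ⟨_, 0, rfl⟩
  exact hi _ ⟨i + 1, rfl⟩ ((hstep i).weight_lt (hinv i))

/-! ### The blocks computed -/

theorem Orbits.Good.block_eq (ho : o.Good τ)
    (hsim : ∀ c d, IsTuple R Set.univ c → IsTuple R Set.univ d →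
      (o.Sim c d ↔ Isomorphic L c d)) {k : ℕ} {a : Fin k → A} {O : Orbit R}
    (hO : o.IsOrbitOf (List.ofFn a) O) :
    O.B = {t | ∃ b : Fin k → A, Function.Injective b ∧ TupleIso L a b ∧ t = List.ofFn b} := by
  have ha := (ho.tuple _ O hO.1 _ hO.2).2
  ext t
  constructor
  · intro ht
    obtain ⟨hlen, htt⟩ := ho.tuple _ O hO.1 t ht
    rw [List.length_ofFn] at hlen
    subst hlen
    refine ⟨t.get, List.nodup_iff_injective_get.1 htt.2.1, ?_, (List.ofFn_get t).symm⟩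
    rw [tupleIso_iff_isomorphic, List.ofFn_get]
    exact (hsim _ _ ha htt).1 ⟨O, hO, ho.isOrbitOf_of_mem hO.1 ht⟩
  · rintro ⟨b, hb, hab, rfl⟩
    have hbt : IsTuple R Set.univ (List.ofFn b) :=
      ⟨by simpa using ha.1, List.nodup_ofFn.2 hb, fun _ _ => trivial⟩
    obtain ⟨O', h1, h2⟩ := (hsim _ _ ha hbt).2 (tupleIso_iff_isomorphic.1 hab)
    rw [ho.unique _ _ _ hO h1]
    exact h2.2

theorem Orbits.Good.blocks_eq (ho : o.Good τ)
    (hsim : ∀ c d, IsTuple R Set.univ c → IsTuple R Set.univ d →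
      (o.Sim c d ↔ Isomorphic L c d)) {k : ℕ} (hk : k ∈ spec R) :
    {B | ∃ O ∈ o k, O.B = B} =
      {B | ∃ a : Fin k → A, Function.Injective a ∧
        B = {t | ∃ b : Fin k → A, Function.Injective b ∧ TupleIso L a b ∧ t = List.ofFn b}} := by
  ext B
  constructor
  · rintro ⟨O, hO, rfl⟩
    obtain ⟨c, hc⟩ := ho.nonempty k O hO
    obtain ⟨rfl, hct⟩ := ho.tuple k O hO c hc
    refine ⟨c.get, List.nodup_iff_injective_get.1 hct.2.1, ho.block_eq hsim ?_⟩
    rw [List.ofFn_get]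
    exact ⟨hO, hc⟩
  · rintro ⟨a, ha, rfl⟩
    obtain ⟨O, hO⟩ := ho.exists_orbit (List.ofFn a)
      ⟨by simpa using hk, List.nodup_ofFn.2 ha, fun _ _ => trivial⟩
    have hOk := hO.1
    rw [List.length_ofFn] at hOk
    exact ⟨O, hOk, ho.block_eq hsim hO⟩

end Steps

end QFMerging

theorem mainTheorem3 {L : FirstOrder.Language} [L.IsAlgebraic] [IsEmpty L.Constants]
    (τ : QFMerging.Vocabulary L)
    {A : Type*} [L.Structure A] [Nonempty A] [Fintype A] [DecidableEq A]
    {n : ℕ} (R : Set (Fin n → A)) :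
    -- the algorithm can start on every input
    (∃ s, QFMerging.IsInitial R s) ∧
    -- no execution is infinite
    (¬ ∃ s : ℕ → QFMerging.State R, QFMerging.IsInitial R (s 0) ∧
      ∀ i, QFMerging.Step τ (s i) (s (i + 1))) ∧
    -- an execution can get stuck only by returning a truth value
    (∀ s, QFMerging.Reachable τ R s →
      (∃ s', QFMerging.Step τ s s') ∨ ∃ b o, s = QFMerging.State.halt b o) ∧
    -- the returned value is correct
    (∀ b o, QFMerging.Reachable τ R (QFMerging.State.halt b o) →
      (b = true ↔ QFMerging.QfDefinable L R)) ∧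
    -- if it is `True`, the blocks computed are the isomorphism classes of tuples
    (∀ o, QFMerging.Reachable τ R (QFMerging.State.halt true o) →
      ∀ k ∈ QFMerging.spec R,
        {B | ∃ O ∈ o k, O.B = B} =
          {B | ∃ a : Fin k → A, Function.Injective a ∧
            B = {t | ∃ b : Fin k → A, Function.Injective b ∧ QFMerging.TupleIso L a b ∧
              t = List.ofFn b}}) ∧
    -- orbits are merged only along subisomorphisms
    (∀ γ o st, QFMerging.Reachable τ R (QFMerging.State.merging γ o st) →
      QFMerging.IsSubisomorphism L γ) := by
  refine ⟨?_, QFMerging.not_exists_infinite_execution, fun s hs => hs.invariant.exists_step,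
    fun b o h => h.invariant.1, fun o h k hk => ?_, fun γ o st h => ?_⟩
  · obtain ⟨l, hl⟩ := QFMerging.exists_isTupleList R Set.univ
    exact ⟨_, l, hl, rfl⟩
  · obtain ⟨ho, hsim⟩ := h.invariant.2 rfl
    exact ho.blocks_eq hsim hk
  · obtain ⟨-, hγ, hne, -⟩ := h.invariant
    exact hγ.isSubisomorphism hne
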